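/- Let $q\ge 2$ be an integer, let $\mathcal T_{q+1}$ be the $(q+1)$-regular tree with vertex set $V$, graph distance $d$ and boundary $\partial\mathcal T_{q+1}$ (the set of infinite paths without repeated vertices, two such paths being identified when they coincide from some point on, up to a shift of indices). Endow $\mathrm{Aut}(\mathcal T_{q+1})$ with the topology of pointwise convergence on $V$, and let $G$ be a closed non-compact subgroup of $\mathrm{Aut}(\mathcal T_{q+1})$ that acts transitively on $V$ and on $\partial\mathcal T_{q+1}$. Hilbert spaces are either all real or all complex. If $G$ acts on a Hilbert space $\mathcal H$ by affine isometries, a map $F:V\to\mathcal H$ is called $G$-equivariant if $F(gx)=g\cdot F(x)$ for all $g\in G$, $x\in V$; it is called harmonic if $\frac1{q+1}\sum_{y\sim x}F(y)=F(x)$ for all $x\in V$. (i) Suppose that $G$ acts on a Hilbert space $\mathcal H$ by affine isometries. Let $F:V\to\mathcal H$ be a $G$-equivariant map with $F(x_0)=0$ for some $x_0\in V$, and let $x_1$ be any vertex adjacent to $x_0$. Then for all $x\in V$ $$\|F(x)\|^2\le A\,d(x,x_0)-B+B\,q^{-d(x,x_0)},\qquad A=\frac{(q+1)\|F(x_1)\|^2}{q-1},\quad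 B=\frac{2q\|F(x_1)\|^2}{(q-1)^2}.$$ (ii) If moreover $F$ is harmonic and non-constant, then equality holds in (i) for all $x\in V$. (iii) There exist a Hilbert space $\mathcal H$, a continuous action of $G$ on $\mathcal H$ by affine isometries, and a $G$-equivariant map $F:V\to\mathcal H$ that is harmonic and non-constant. -/

import Mathlib

universe u v w

namespace SimpleGraph

/-- The permutation topology (topology of pointwise convergence on vertices, the vertex set being
discrete) on the automorphism group of a graph. -/
instance autTopologicalSpace {V : Type u} (T : SimpleGraph V) : TopologicalSpace (T ≃g T) :=
  TopologicalSpace.induced (fun (g : T ≃g T) (x : V) => g x)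
    (@Pi.topologicalSpace V (fun _ => V) (fun _ => ⊥))

/-- A ray: an infinite path without repeated vertices. -/
structure InfRay {V : Type u} (T : SimpleGraph V) where
  /-- The vertices of the ray, in order. -/
  vert : ℕ → V
  adj : ∀ n, T.Adj (vert n) (vert (n + 1))
  inj : Function.Injective vert

/-- Two rays are equivalent when they coincide from some point on, up to a shift of indices. -/
instance infRaySetoid {V : Type u} (T : SimpleGraph V) : Setoid (InfRay T) where
  r a b := ∃ m n : ℕ, ∀ k : ℕ, a.vert (m + k) = b.vert (n + k)
  iseqv :=
    { refl := fun _ => ⟨0, 0, fun _ => rfl⟩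
      symm := fun ⟨m, n, h⟩ => ⟨n, m, fun k => (h k).symm⟩
      trans := by
        rintro a b c ⟨m, n, h⟩ ⟨m', n', h'⟩
        refine ⟨m + m', n' + n, fun k => ?_⟩
        have h1 := h (m' + k)
        have h2 := h' (n + k)
        rw [show m + m' + k = m + (m' + k) by omega, h1,
          show n + (m' + k) = m' + (n + k) by omega, h2,
          show n' + (n + k) = n' + n + k by omega] }

/-- The boundary `∂T` of a tree: rays modulo equivalence. -/
def TreeBoundary {V : Type u} (T : SimpleGraph V) : Type u :=
  Quotient (infRaySetoid T)

/-- The image of a ray under an automorphism. -/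
def InfRay.map {V : Type u} {T : SimpleGraph V} (g : T ≃g T) (a : InfRay T) : InfRay T where
  vert n := g (a.vert n)
  adj n := g.map_rel_iff.mpr (a.adj n)
  inj := g.injective.comp a.inj

/-- The natural action of the automorphism group on the boundary. -/
instance treeBoundaryAction {V : Type u} (T : SimpleGraph V) :
    MulAction (T ≃g T) (TreeBoundary T) where
  smul g := Quotient.map (InfRay.map g)
    (fun _ _ ⟨m, n, h⟩ => ⟨m, n, fun k => congrArg g (h k)⟩)
  one_smul := by rintro ⟨a⟩; rfl
  mul_smul := by rintro g h ⟨a⟩; rfl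

/-- The Laplace operator `(𝓛F)(x) = (1 / deg x) ∑_{y ∼ x} F y - F x` of a locally finite graph,
acting on vector-valued functions. -/
noncomputable def laplaceOp (𝕜 : Type w) [RCLike 𝕜] {V : Type u} (T : SimpleGraph V)
    [T.LocallyFinite] {H : Type v} [NormedAddCommGroup H] [InnerProductSpace 𝕜 H]
    (F : V → H) (x : V) : H :=
  ((T.degree x : 𝕜)⁻¹ • ∑ y ∈ T.neighborFinset x, F y) - F x

/-- A map on the vertices is harmonic when its Laplacian vanishes identically. -/
def IsHarmonicMap (𝕜 : Type w) [RCLike 𝕜] {V : Type u} (T : SimpleGraph V)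
    [T.LocallyFinite] {H : Type v} [NormedAddCommGroup H] [InnerProductSpace 𝕜 H]
    (F : V → H) : Prop :=
  ∀ x : V, laplaceOp 𝕜 T F x = 0

/-- `F : V → H` is equivariant, where `G` acts on `H` by affine isometries through `α`. -/
def IsEquivariantMap {𝕜 : Type w} [RCLike 𝕜] {V : Type u} {T : SimpleGraph V}
    {G : Subgroup (T ≃g T)} {H : Type v} [NormedAddCommGroup H] [InnerProductSpace 𝕜 H]
    (α : G →* (H ≃ᵃⁱ[𝕜] H)) (F : V → H) : Prop :=
  ∀ (g : G) (x : V), F (g • x) = α g (F x)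

/-- `F` takes at least two different values. -/
def IsNonconstantMap {V : Type u} {H : Type v} (F : V → H) : Prop :=
  ∃ x y : V, F x ≠ F y

end SimpleGraph

/-! A closed group that is transitive on the vertices and on the boundary is transitive on pairs of
vertices at equal distance (`exists_map_pair_of_dist_eq`). So for equivariant F, ‖F x - F y‖² =
ψ(d(x, y)), and (i) and (ii) become statements about the single sequence ψ.

For an edge xy, let σ_n be the size of the n-spheres, v_n the difference of the sums of F over the
n-spheres around x and y, and a_n = ⟨F x - F y, v_n⟩. The heart of (i) is |a_n| ≤ σ_n ψ(1)
(`IsDistTransitive.abs_inner_le`). When ψ(1) > 0, put β_n = |a_n| / (σ_n ψ(1)). Cauchy-Schwarz, with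
the expansion of a twofold sphere sum in sphere sums, gives β_n² ≤ β_k for some k ≤ 2n; since ψ
grows at most quadratically, this forces β_n ≤ 1. Counting distances turns the bound into q ψ(n+2) +
ψ(n) ≤ (q+1)(ψ(n+1) + ψ(1)), whose extremal solution is the stated right-hand side. If F is
harmonic, a cross term vanishes and the recurrence is an equality.

For (iii), each oriented edge carries an explicit harmonic function `edgeHeight`. Moving its
argument by one step changes it by O(q^(-d)), d being the distance to the edge, so the family of
differences between two vertices is square summable. This gives a harmonic map into ℓ², equivariant
for the permutation representation corrected by translations. -/

namespace SimpleGraph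

/-! ### Distances and spheres in regular trees -/

section TreeMetric

variable {V : Type u} {T : SimpleGraph V}

lemma Connected.dist_map_le (hT : T.Connected) (g : T ≃g T) (x y : V) :
    T.dist (g x) (g y) ≤ T.dist x y := by
  obtain ⟨p, hp⟩ := hT.exists_walk_length_eq_dist x y
  rw [← hp, ← Walk.length_map g.toHom p]
  exact dist_le _

lemma Connected.dist_map (hT : T.Connected) (g : T ≃g T) (x y : V) :
    T.dist (g x) (g y) = T.dist x y := by
  refine le_antisymm (hT.dist_map_le g x y) ?_
  simpa using hT.dist_map_le g.symm (g x) (g y)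

lemma Connected.exists_adj_closer (hT : T.Connected) {v z : V} (hvz : v ≠ z) :
    ∃ w, T.Adj v w ∧ T.dist z v = T.dist z w + 1 := by
  obtain ⟨p, hp⟩ := hT.exists_walk_length_eq_dist v z
  cases p with
  | nil => exact absurd rfl hvz
  | @cons _ w _ h p =>
    refine ⟨w, h, ?_⟩
    rw [Walk.length_cons] at hp
    have h1 : T.dist w z ≤ p.length := dist_le p
    have h2 := hT.dist_triangle (u := v) (v := w) (w := z)
    rw [dist_eq_one_iff_adj.mpr h] at h2
    rw [dist_comm (v := v), dist_comm (v := w)]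
    omega

/-- Extending geodesics from z to w and to w' by the last edge gives two paths from z to v; paths in
a tree are unique, so their penultimate vertices agree. -/
lemma IsTree.closer_unique (hT : T.IsTree) {z v w w' : V} (h : T.Adj v w) (h' : T.Adj v w')
    (hd : T.dist z v = T.dist z w + 1) (hd' : T.dist z v = T.dist z w' + 1) : w = w' := by
  obtain ⟨p, hp⟩ := hT.connected.exists_walk_length_eq_dist z w
  obtain ⟨p', hp'⟩ := hT.connected.exists_walk_length_eq_dist z w'
  have h1 : (p.concat h.symm).IsPath := Walk.isPath_of_length_eq_dist _ (by simp; omega)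
  have h2 : (p'.concat h'.symm).IsPath := Walk.isPath_of_length_eq_dist _ (by simp; omega)
  have h3 := (hT.existsUnique_path z v).unique h1 h2
  have h4 := congrArg Walk.penultimate h3
  simpa using h4

/-- Each edge other than `{a, b}` lies on one side of the edge `{a, b}`. -/
lemma IsTree.eq_of_dist_lt_of_dist_lt (hT : T.IsTree) {a b x y : V} (hab : T.Adj a b)
    (hxy : T.Adj x y) (hx : T.dist a x = T.dist b x + 1) (hy : T.dist b y = T.dist a y + 1) :
    b = x ∧ a = y := by
  have h1 := hT.dist_eq_dist_add_one_of_adj a hxy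
  have h2 := hT.dist_eq_dist_add_one_of_adj b hxy
  have hbx : b = x := by
    by_contra hne
    -- The step from x towards b also approaches a. So does the step to y, hence z = y; but y is
    -- farther from b than x is.
    obtain ⟨z, hz, hdz⟩ := hT.connected.exists_adj_closer (v := x) (z := b) (Ne.symm hne)
    have h3 := hT.connected.dist_triangle (u := a) (v := b) (w := z)
    rw [dist_eq_one_iff_adj.mpr hab] at h3
    have h4 := hT.dist_eq_dist_add_one_of_adj a hz
    have : z = y := hT.closer_unique hz hxy (z := a) (by omega) (by omega)
    subst this
    omega
  subst hbx
  refine ⟨rfl, ?_⟩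
  rw [dist_self] at *
  have : T.dist a y = 0 := by omega
  exact hT.connected.dist_eq_zero_iff.mp this

/-- The automorphism group of the graph acts transitively on the pairs of vertices at any given
distance. -/
def IsDistTransitive (T : SimpleGraph V) : Prop :=
  ∀ x y x' y' : V, T.dist x y = T.dist x' y' → ∃ g : T ≃g T, g x = x' ∧ g y = y'

open Classical in
/-- The sphere of radius `n` around `x`, as a finset (empty if it is infinite). -/
noncomputable def distSphere (T : SimpleGraph V) (x : V) (n : ℕ) : Finset V :=
  if h : {z | T.dist x z = n}.Finite then h.toFinset else ∅

variable [T.LocallyFinite]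

lemma Connected.finite_dist_eq (hT : T.Connected) (x : V) (n : ℕ) :
    {z | T.dist x z = n}.Finite := by
  classical
  induction n with
  | zero =>
    refine (Set.finite_singleton x).subset fun z hz => ?_
    exact (hT.dist_eq_zero_iff.mp hz).symm
  | succ n ih =>
    refine (ih.biUnion fun z _ => (T.neighborFinset z).finite_toSet).subset fun z hz => ?_
    have hne : z ≠ x := by
      rintro rfl
      simp at hz
    obtain ⟨w, hw, hd⟩ := hT.exists_adj_closer hne
    simp only [Set.mem_iUnion, Set.mem_ofPred_eq] at hz ⊢
    exact ⟨w, by omega, by simpa using hw.symm⟩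

lemma Connected.mem_distSphere (hT : T.Connected) {x z : V} {n : ℕ} :
    z ∈ T.distSphere x n ↔ T.dist x z = n := by
  rw [distSphere, dif_pos (hT.finite_dist_eq x n)]
  simp

lemma Connected.countable (hT : T.Connected) : Countable V := by
  obtain ⟨x⟩ := hT.nonempty
  have : (⋃ n, {z | T.dist x z = n}) = Set.univ := by
    ext z
    simp
  rw [← Set.countable_univ_iff, ← this]
  exact Set.countable_iUnion fun n => (hT.finite_dist_eq x n).countable

lemma Connected.card_distSphere_map (hT : T.Connected) (g : T ≃g T) (x : V) (n : ℕ) :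
    (T.distSphere (g x) n).card = (T.distSphere x n).card := by
  symm
  refine Finset.card_bij (fun z _ => g z) ?_ (fun _ _ _ _ h => g.injective h) ?_
  · intro z hz
    rw [hT.mem_distSphere] at hz ⊢
    rw [hT.dist_map, hz]
  · intro z hz
    refine ⟨g.symm z, ?_, by simp⟩
    rw [hT.mem_distSphere] at hz ⊢
    rw [← hT.dist_map g]
    simpa using hz

/-- A crude count, sufficient for the ℓ² estimate because (q + 1) / q² < 1 when q ≥ 2. -/
lemma Connected.card_distSphere_le (hT : T.Connected) {q : ℕ}
    (hreg : T.IsRegularOfDegree (q + 1)) (x : V) (n : ℕ) :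
    (T.distSphere x n).card ≤ (q + 1) ^ n := by
  classical
  induction n with
  | zero =>
    rw [pow_zero, Finset.card_le_one]
    intro a ha b hb
    rw [hT.mem_distSphere, hT.dist_eq_zero_iff] at ha hb
    rw [← ha, ← hb]
  | succ n ih =>
    have hsub : T.distSphere x (n + 1) ⊆ (T.distSphere x n).biUnion fun z => T.neighborFinset z := by
      intro z hz
      rw [hT.mem_distSphere] at hz
      have hne : z ≠ x := by
        rintro rfl
        simp at hz
      obtain ⟨w, hw, hd⟩ := hT.exists_adj_closer hne
      rw [Finset.mem_biUnion]
      exact ⟨w, hT.mem_distSphere.mpr (by omega), by simpa using hw.symm⟩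
    calc _ ≤ _ := Finset.card_le_card hsub
      _ ≤ (T.distSphere x n).card * (q + 1) :=
        Finset.card_biUnion_le_card_mul _ _ _ fun z _ => (hreg z).le
      _ ≤ (q + 1) ^ n * (q + 1) := by gcongr
      _ = _ := (pow_succ _ _).symm

/-- Summing a function of the distance to `z` over the neighbours of a vertex. -/
lemma IsTree.sum_neighborFinset_dist (hT : T.IsTree) {q : ℕ}
    (hreg : T.IsRegularOfDegree (q + 1)) (f : ℕ → ℝ) {x z : V} {n : ℕ}
    (h : T.dist z x = n + 1) :
    ∑ y ∈ T.neighborFinset x, f (T.dist z y) = f n + q * f (n + 2) := by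
  classical
  have hne : x ≠ z := by
    rintro rfl
    simp at h
  obtain ⟨w, hw, hd⟩ := hT.connected.exists_adj_closer hne
  have hmem : w ∈ T.neighborFinset x := by simpa using hw
  rw [← Finset.add_sum_erase _ _ hmem]
  have h1 : ∀ y ∈ (T.neighborFinset x).erase w, f (T.dist z y) = f (n + 2) := by
    intro y hy
    rw [Finset.mem_erase, mem_neighborFinset] at hy
    congr 1
    rcases hT.dist_eq_dist_add_one_of_adj z hy.2 with h2 | h2
    · exact absurd (hT.closer_unique hy.2 hw h2 hd) hy.1
    · omega
  rw [Finset.sum_congr rfl h1, Finset.sum_const, Finset.card_erase_of_mem hmem,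
    card_neighborFinset_eq_degree, hreg x, show T.dist z w = n by omega]
  simp

lemma IsTree.exists_adj_farther (hT : T.IsTree) {q : ℕ} (hq : 1 ≤ q)
    (hreg : T.IsRegularOfDegree (q + 1)) (z v : V) :
    ∃ w, T.Adj v w ∧ T.dist z w = T.dist z v + 1 := by
  by_contra! hcon
  have hc : ∀ w ∈ T.neighborFinset v, T.dist z v = T.dist z w + 1 := by
    intro w hw
    rw [mem_neighborFinset] at hw
    have := hcon w hw
    have := hT.dist_eq_dist_add_one_of_adj z hw
    omega
  have : (T.neighborFinset v).card ≤ 1 := by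
    rw [Finset.card_le_one]
    intro a ha b hb
    exact hT.closer_unique (by simpa using ha) (by simpa using hb) (hc a ha) (hc b hb)
  rw [card_neighborFinset_eq_degree, hreg v] at this
  omega

lemma IsTree.exists_dist_eq (hT : T.IsTree) {q : ℕ} (hq : 1 ≤ q)
    (hreg : T.IsRegularOfDegree (q + 1)) (x : V) (n : ℕ) : ∃ z, T.dist x z = n := by
  induction n with
  | zero => exact ⟨x, dist_self⟩
  | succ n ih =>
    obtain ⟨z, hz⟩ := ih
    obtain ⟨w, -, hw⟩ := hT.exists_adj_farther hq hreg x z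
    exact ⟨w, by omega⟩

end TreeMetric

end SimpleGraph

namespace SimpleGraph

/-! ### Ends as coherent orientations of the edges -/

section Ends

variable {V : Type u} {T : SimpleGraph V}

/-- An end of a tree, encoded by the map sending each vertex to its neighbour towards the end. -/
def IsEndMap (T : SimpleGraph V) (p : V → V) : Prop :=
  (∀ v, T.Adj v (p v)) ∧ ∀ v w, T.Adj v w → (p v = w ↔ ¬ p w = v)

/-- The action of automorphisms on end maps. -/
def conjMap (g : T ≃g T) (p : V → V) : V → V := fun v => g (p (g.symm v))

lemma conjMap_mul (g h : T ≃g T) (p : V → V) : conjMap (g * h) p = conjMap g (conjMap h p) := rfl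

lemma conjMap_one (p : V → V) : conjMap (1 : T ≃g T) p = p := rfl

lemma conjMap_inv_eq_iff (g : T ≃g T) (p p' : V → V) :
    conjMap g⁻¹ p = p' ↔ p = conjMap g p' := by
  constructor
  · rintro rfl
    rw [← conjMap_mul, mul_inv_cancel, conjMap_one]
  · rintro rfl
    rw [← conjMap_mul, inv_mul_cancel, conjMap_one]

lemma conjMap_apply_apply (g : T ≃g T) (p : V → V) (v : V) : conjMap g p (g v) = g (p v) := by
  simp [conjMap]

lemma conjMap_iterate (g : T ≃g T) (p : V → V) (n : ℕ) (v : V) :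
    (conjMap g p)^[n] v = g (p^[n] (g.symm v)) := by
  induction n with
  | zero => simp
  | succ n ih => simp only [Function.iterate_succ_apply', ih, conjMap_apply_apply]

namespace IsEndMap

lemma conj {p : V → V} (hp : T.IsEndMap p) (g : T ≃g T) : T.IsEndMap (conjMap g p) := by
  constructor
  · intro v
    have := g.map_rel_iff.mpr (hp.1 (g.symm v))
    simpa [conjMap] using this
  · intro v w h
    have h1 : T.Adj (g.symm v) (g.symm w) := g.symm.map_rel_iff.mpr h
    have h2 := hp.2 _ _ h1
    have h3 : ∀ a b, g (p a) = b ↔ p a = g.symm b := fun a b =>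
      ⟨fun h => by rw [← h]; simp, fun h => by rw [h]; simp⟩
    simp only [conjMap, h3]
    exact h2

/-- The second clause of `IsEndMap` forbids backtracking, so the orbit of x under p is geodesic. -/
lemma iterate_dist {p : V → V} (hp : T.IsEndMap p) (hT : T.IsTree) (x : V) (n : ℕ) :
    T.dist x (p^[n] x) = n ∧ T.dist x (p^[n + 1] x) = n + 1 := by
  induction n with
  | zero => simpa using hp.1 x
  | succ n ih =>
    refine ⟨ih.2, ?_⟩
    have hadj := hp.1 (p^[n + 1] x)
    have hadj' := hp.1 (p^[n] x)
    rw [← Function.iterate_succ_apply' p (n + 1) x] at hadj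
    rw [← Function.iterate_succ_apply' p n x] at hadj'
    rcases hT.dist_eq_dist_add_one_of_adj x hadj with h | h
    · exfalso
      have := hT.closer_unique (z := x) hadj hadj'.symm h (by omega)
      rw [Function.iterate_succ_apply' p (n + 1) x] at this
      exact (hp.2 _ _ hadj').mp (Function.iterate_succ_apply' p n x).symm this
    · rw [h, ih.2]

/-- An edge not followed by p from one endpoint is followed from the other. Hence if p leaves x away
from a, every edge of the geodesic from a to x is oriented towards x. -/
lemma iterate_dist_add_one {p : V → V} (hp : T.IsEndMap p) (hT : T.IsTree) {a x : V} {n : ℕ}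
    (hn : T.dist a x = n) (h : T.dist a (p x) = n + 1) : p^[n] a = x := by
  induction n generalizing x with
  | zero => simpa using hT.connected.dist_eq_zero_iff.mp hn
  | succ n ih =>
    have hne : x ≠ a := by
      rintro rfl
      simp at hn
    obtain ⟨w, hw, hd⟩ := hT.connected.exists_adj_closer hne
    have h1 : p x ≠ w := by
      rintro rfl
      omega
    have h2 : p w = x := (hp.2 w x hw.symm).mpr h1
    have := ih (x := w) (by omega) (by rw [h2]; omega)
    rw [Function.iterate_succ_apply', this, h2]

lemma exists_iterate_eq {p : V → V} (hp : T.IsEndMap p) (hT : T.Connected) (v w : V) :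
    ∃ a b, p^[a] v = p^[b] w := by
  obtain ⟨W⟩ := hT v w
  induction W with
  | nil => exact ⟨0, 0, rfl⟩
  | @cons v v' w h _ ih =>
    obtain ⟨a, b, hab⟩ := ih
    by_cases hv : p v = v'
    · exact ⟨a + 1, b, by rw [Function.iterate_succ_apply, hv, hab]⟩
    · have hv' : p v' = v := (hp.2 v' v h.symm).mpr hv
      refine ⟨a, b + 1, ?_⟩
      rw [Function.iterate_succ_apply', ← hab, ← hv', ← Function.iterate_succ_apply,
        Function.iterate_succ_apply']

/-- An end is determined by its ray from one vertex: agreement of the rays propagates across each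
edge. -/
lemma eq_of_iterate_eq {p p' : V → V} (hp : T.IsEndMap p) (hp' : T.IsEndMap p')
    (hT : T.Connected) {y : V} (h : ∀ k, p^[k] y = p'^[k] y) : p = p' := by
  have key : ∀ v, ∀ k, p^[k] v = p'^[k] v := by
    intro v
    obtain ⟨W⟩ := hT v y
    induction W with
    | nil => exact h
    | @cons v v' w hadj _ ih =>
      have ih := ih h
      have h1 : p v' = p' v' := ih 1
      by_cases hv : p v' = v
      · intro k
        have := ih (k + 1)
        rwa [Function.iterate_succ_apply, Function.iterate_succ_apply, ← h1, hv] at this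
      · have h2 : p v = v' := (hp.2 v v' hadj).mpr hv
        have h3 : p' v = v' := (hp'.2 v v' hadj).mpr (h1 ▸ hv)
        rintro (_ | k)
        · rfl
        · rw [Function.iterate_succ_apply, Function.iterate_succ_apply, h2, h3, ih]
  funext v
  exact key v 1

/-- The ray from `x` towards the end `p`. -/
def ray {p : V → V} (hp : T.IsEndMap p) (hT : T.IsTree) (x : V) : InfRay T where
  vert n := p^[n] x
  adj n := by
    rw [Function.iterate_succ_apply']
    exact hp.1 _
  inj m n h := by
    rw [← (hp.iterate_dist hT x m).1, ← (hp.iterate_dist hT x n).1]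
    exact congrArg _ h

/-- Transfers transitivity on classes of rays to end maps. The rays need only agree after shifts, so
the end maps are compared from a vertex where the rays have already merged. -/
lemma exists_conjMap_eq {p p' : V → V} (hp : T.IsEndMap p) (hp' : T.IsEndMap p') (hT : T.IsTree)
    {G : Subgroup (T ≃g T)} (htransB : MulAction.IsPretransitive G (TreeBoundary T)) :
    ∃ g ∈ G, conjMap g p = p' := by
  obtain ⟨x⟩ := hT.connected.nonempty
  obtain ⟨⟨g, hg⟩, hgp⟩ := htransB.exists_smul_eq (Quotient.mk _ (hp.ray hT x))
    (Quotient.mk _ (hp'.ray hT x))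
  have h1 : (hp.ray hT x).map g ≈ hp'.ray hT x := Quotient.exact hgp
  have h2 : (hp.conj g).ray hT x ≈ (hp.ray hT x).map g := by
    obtain ⟨a, b, hab⟩ := hp.exists_iterate_eq hT.connected (g.symm x) x
    refine ⟨a, b, fun k => ?_⟩
    change (conjMap g p)^[a + k] x = g (p^[b + k] x)
    rw [conjMap_iterate, add_comm a, add_comm b, Function.iterate_add_apply,
      Function.iterate_add_apply, hab]
  obtain ⟨m, n, hmn⟩ := Setoid.trans h2 h1
  refine ⟨g, hg, ?_⟩
  set r := conjMap g p with hr
  have h3 : ∀ k, r^[m + k] x = p'^[n + k] x := hmn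
  have h4 : r^[m] x = p'^[n] x := h3 0
  refine (hp.conj g).eq_of_iterate_eq hp' hT.connected (y := r^[m] x) fun k => ?_
  rw [← hr, ← Function.iterate_add_apply, add_comm, h3, add_comm, Function.iterate_add_apply, h4]

end IsEndMap

/-- Every oriented edge points to some end. -/
lemma IsTree.exists_isEndMap [T.LocallyFinite] (hT : T.IsTree) {q : ℕ} (hq : 1 ≤ q)
    (hreg : T.IsRegularOfDegree (q + 1)) {x y : V} (hxy : T.Adj x y) :
    ∃ p, T.IsEndMap p ∧ p x = y := by
  have hz : ∀ n, ∃ z, T.dist x z = n + 1 ∧ T.dist y z = n := by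
    intro n
    induction n with
    | zero => exact ⟨y, by simpa using hxy, dist_self⟩
    | succ n ih =>
      obtain ⟨z, h1, h2⟩ := ih
      obtain ⟨w, hw, hd⟩ := hT.exists_adj_farther hq hreg x z
      refine ⟨w, by omega, ?_⟩
      have h3 := hT.dist_eq_dist_add_one_of_adj y hw
      have h4 := hT.connected.dist_triangle (u := x) (v := y) (w := w)
      rw [dist_eq_one_iff_adj.mpr hxy] at h4
      omega
  choose z hz1 hz2 using hz
  -- The end is an ultrafilter limit of the maps "one step towards z n"; finiteness of the
  -- neighbourhoods makes the limit exist at every vertex. The z n need not form a ray.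
  have hev : ∀ v, ∃ w ∈ T.neighborSet v,
      ∀ᶠ n in (Filter.hyperfilter ℕ : Filter ℕ), T.dist (z n) v = T.dist (z n) w + 1 := by
    intro v
    rw [← Ultrafilter.eventually_exists_mem_iff (Set.toFinite _)]
    have h1 : ∀ᶠ n in (Filter.hyperfilter ℕ : Filter ℕ), T.dist x v < n := by
      have := Filter.eventually_gt_atTop (T.dist x v)
      rw [← Nat.cofinite_eq_atTop] at this
      exact Filter.hyperfilter_le_cofinite this
    filter_upwards [h1] with n hn
    have hne : v ≠ z n := by
      rintro rfl
      have := hz1 n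
      omega
    exact hT.connected.exists_adj_closer hne
  choose p hp1 hp2 using hev
  refine ⟨p, ⟨hp1, fun v w hvw => ?_⟩, ?_⟩
  · obtain ⟨n, h1, h2⟩ := ((hp2 v).and (hp2 w)).exists
    constructor
    · intro h h'
      rw [h] at h1
      rw [h'] at h2
      omega
    · intro h
      rcases hT.dist_eq_dist_add_one_of_adj (z n) hvw with h3 | h3
      · exact hT.closer_unique (hp1 v) hvw h1 h3
      · exact absurd (hT.closer_unique (hp1 w) hvw.symm h2 h3) h
  · obtain ⟨n, h1⟩ := (hp2 x).exists
    exact hT.closer_unique (hp1 x) hxy h1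
      (by rw [dist_comm, hz1 n, dist_comm, hz2 n])

end Ends

/-! ### Compactness, Baire category and distance transitivity of G -/

section Topology

variable {V : Type u} {T : SimpleGraph V}

lemma le_nhds_aut_iff (l : Filter (T ≃g T)) (g : T ≃g T) :
    l ≤ nhds g ↔ ∀ v, ∀ᶠ h in l, h v = g v := by
  let _ : TopologicalSpace V := ⊥
  have : DiscreteTopology V := ⟨rfl⟩
  have : nhds g = Filter.comap (fun (h : T ≃g T) (x : V) => h x) (nhds fun x => g x) :=
    nhds_induced _ _
  rw [this, ← Filter.tendsto_iff_comap, tendsto_pi_nhds]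
  simp [nhds_discrete]

lemma isOpen_setOf_apply_eq (v w : V) : IsOpen {g : T ≃g T | g v = w} := by
  rw [isOpen_iff_mem_nhds]
  intro g hg
  filter_upwards [(le_nhds_aut_iff _ g).mp le_rfl v] with h hh
  exact hh.trans hg

/-- Once g x = y is imposed, g and its inverse send each vertex into a finite sphere, so
ultrafilters converge pointwise. Tracking the inverse as well makes the limit bijective, and
closedness keeps it in G. -/
lemma isCompact_setOf_apply_eq [T.LocallyFinite] (hT : T.Connected) {G : Subgroup (T ≃g T)}
    (hclosed : IsClosed (G : Set (T ≃g T))) (x y : V) :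
    IsCompact {g : T ≃g T | g ∈ G ∧ g x = y} := by
  rw [isCompact_iff_ultrafilter_le_nhds]
  intro U hU
  rw [Filter.le_principal_iff] at hU
  have h1 : ∀ v, ∃ w ∈ {w | T.dist y w = T.dist x v}, ∀ᶠ g in (U : Filter (T ≃g T)), g v = w := by
    intro v
    rw [← Ultrafilter.eventually_exists_mem_iff (hT.finite_dist_eq _ _)]
    filter_upwards [hU] with g hg
    exact ⟨g v, by rw [← hT.dist_map g x v, hg.2], rfl⟩
  have h2 : ∀ v, ∃ w ∈ {w | T.dist x w = T.dist y v},
      ∀ᶠ g in (U : Filter (T ≃g T)), g.symm v = w := by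
    intro v
    rw [← Ultrafilter.eventually_exists_mem_iff (hT.finite_dist_eq _ _)]
    filter_upwards [hU] with g hg
    refine ⟨g.symm v, ?_, rfl⟩
    rw [← hT.dist_map g, hg.2]
    simp
  choose f _ hf using h1
  choose f' _ hf' using h2
  let g₀ : T ≃g T :=
    { toFun := f
      invFun := f'
      left_inv := fun v => by
        obtain ⟨g, h1, h2⟩ := ((hf v).and (hf' (f v))).exists
        rw [← h2, ← h1]
        simp
      right_inv := fun v => by
        obtain ⟨g, h1, h2⟩ := ((hf' v).and (hf (f' v))).exists
        rw [← h2, ← h1]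
        simp
      map_rel_iff' := fun {v w} => by
        obtain ⟨g, h1, h2⟩ := ((hf v).and (hf w)).exists
        change T.Adj (f v) (f w) ↔ T.Adj v w
        rw [← h1, ← h2]
        exact g.map_rel_iff }
  have hlim : (U : Filter (T ≃g T)) ≤ nhds g₀ := (le_nhds_aut_iff _ _).mpr hf
  refine ⟨g₀, ⟨?_, ?_⟩, hlim⟩
  · refine isClosed_iff_ultrafilter.mp hclosed g₀ U hlim ?_
    filter_upwards [hU] with g hg using hg.1
  · obtain ⟨g, h1, h2⟩ := ((hf x).and hU).exists
    exact h1.symm.trans h2.2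

lemma continuous_conjMap [TopologicalSpace V] [DiscreteTopology V] (p : V → V) :
    Continuous fun g : T ≃g T => conjMap g p := by
  refine continuous_pi fun v => ?_
  rw [continuous_discrete_rng]
  intro w
  have : (fun g : T ≃g T => conjMap g p v) ⁻¹' {w} =
      ⋃ a, {g : T ≃g T | g a = v} ∩ {g : T ≃g T | g (p a) = w} := by
    ext g
    simp only [Set.mem_preimage, Set.mem_singleton_iff, Set.mem_iUnion, Set.mem_inter_iff,
      Set.mem_ofPred_eq]
    constructor
    · intro h
      exact ⟨g.symm v, by simp, h⟩
    · rintro ⟨a, rfl, h⟩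
      rw [conjMap_apply_apply, h]
  rw [this]
  exact isOpen_iUnion fun a => (isOpen_setOf_apply_eq _ _).inter (isOpen_setOf_apply_eq _ _)

lemma isCompact_setOf_isEndMap [TopologicalSpace V] [DiscreteTopology V] [T.LocallyFinite] :
    IsCompact {p : V → V | T.IsEndMap p} := by
  have h1 : IsCompact (Set.pi Set.univ fun v => T.neighborSet v) :=
    isCompact_univ_pi fun v => (Set.toFinite _).isCompact
  refine h1.of_isClosed_subset ?_ fun p hp v _ => hp.1 v
  have : {p : V → V | T.IsEndMap p} = (⋂ v, (fun p : V → V => p v) ⁻¹' {w | T.Adj v w}) ∩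
      ⋂ v, ⋂ w, (fun p : V → V => (p v, p w)) ⁻¹' {c | T.Adj v w → (c.1 = w ↔ ¬ c.2 = v)} := by
    ext p
    simp [IsEndMap]
  rw [this]
  refine (isClosed_iInter fun v => ?_).inter (isClosed_iInter fun v => isClosed_iInter fun w => ?_)
  · exact (isClosed_discrete _).preimage (continuous_apply v)
  · exact (isClosed_discrete _).preimage ((continuous_apply v).prodMk (continuous_apply w))

/-- A vertex stabilizer has finitely many orbits on the ends. -/
lemma exists_finite_orbit_representatives [T.LocallyFinite] (hT : T.IsTree)
    {G : Subgroup (T ≃g T)} (hclosed : IsClosed (G : Set (T ≃g T)))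
    (htransB : MulAction.IsPretransitive G (TreeBoundary T)) (x : V) :
    ∃ t : Set (V → V), t.Finite ∧ ∀ p, T.IsEndMap p → ∃ e ∈ t, ∃ g ∈ G, g x = x ∧
      conjMap g e = p := by
  let _ : TopologicalSpace V := ⊥
  have : DiscreteTopology V := ⟨rfl⟩
  let E := {p : V → V | T.IsEndMap p}
  have : CompactSpace E := isCompact_iff_compactSpace.mp isCompact_setOf_isEndMap
  have : Countable V := hT.connected.countable
  have hnhds : ∀ p : E, {e : E | ∃ g ∈ G, g x = x ∧ conjMap g p.1 = e.1} ∈ nhds p := by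
    intro p
    have : Nonempty E := ⟨p⟩
    -- The ends are covered by the countably many compact sets of images of p under elements sending
    -- x to v. By Baire one has an interior point; translating it back by g₀ gives a neighbourhood
    -- of p inside the orbit of p under the stabilizer of x.
    obtain ⟨v, e₀, he₀⟩ := nonempty_interior_of_iUnion_of_closed
      (f := fun v => {e : E | ∃ g ∈ G, g x = v ∧ conjMap g p.1 = e.1}) (by
        intro v
        have h1 := (isCompact_setOf_apply_eq hT.connected hclosed x v).image
          (continuous_conjMap p.1)
        convert h1.isClosed.preimage (continuous_subtype_val (p := fun e => e ∈ E)) using 1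
        ext e
        simp [and_assoc]) (by
        ext e
        obtain ⟨g, hg, hge⟩ := p.2.exists_conjMap_eq e.2 hT htransB
        simp only [Set.mem_iUnion, Set.mem_univ, iff_true]
        exact ⟨g x, g, hg, rfl, hge⟩)
    obtain ⟨g₀, hg₀, hg₀x, hge⟩ := interior_subset he₀
    let φ : E → E := fun e => ⟨conjMap g₀ e.1, IsEndMap.conj e.2 g₀⟩
    have hφ : Continuous φ := by
      refine Continuous.subtype_mk (continuous_pi fun v => ?_) _
      exact continuous_of_discreteTopology.comp
        ((continuous_apply (g₀.symm v)).comp continuous_subtype_val)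
    have hφp : φ p = e₀ := Subtype.ext hge
    have := hφ.continuousAt.preimage_mem_nhds (x := p)
      (hφp ▸ isOpen_interior.mem_nhds he₀)
    filter_upwards [this] with e he
    obtain ⟨g, hg, hgx, hge'⟩ := interior_subset he
    refine ⟨g₀⁻¹ * g, mul_mem (inv_mem hg₀) hg, ?_, ?_⟩
    · change g₀.symm (g x) = x
      rw [hgx, ← hg₀x]
      simp
    · rw [conjMap_mul, conjMap_inv_eq_iff, hge']
  obtain ⟨t, ht⟩ := CompactSpace.elim_nhds_subcover _ hnhds
  refine ⟨Subtype.val '' (t : Set E), t.finite_toSet.image _, fun p hp => ?_⟩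
  have : (⟨p, hp⟩ : E) ∈ (⊤ : Set E) := trivial
  rw [← ht, Set.mem_iUnion₂] at this
  obtain ⟨e, he, g, hg, hgx, hge⟩ := this
  exact ⟨e.1, ⟨e, he, rfl⟩, g, hg, hgx, hge⟩

/-- The stabilizer of an end acts transitively on the vertices with the same `n`-th successor. -/
lemma IsEndMap.exists_of_iterate_eq [T.LocallyFinite] (hT : T.IsTree) {q : ℕ} (hq : 1 ≤ q)
    (hreg : T.IsRegularOfDegree (q + 1)) {G : Subgroup (T ≃g T)}
    (hclosed : IsClosed (G : Set (T ≃g T))) (htransV : MulAction.IsPretransitive G V)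
    (htransB : MulAction.IsPretransitive G (TreeBoundary T)) {p : V → V} (hp : T.IsEndMap p)
    {n : ℕ} {v w : V} (h : p^[n] v = p^[n] w) :
    ∃ g ∈ G, conjMap g p = p ∧ g v = w := by
  obtain ⟨x⟩ := hT.connected.nonempty
  obtain ⟨t, ht, hcov⟩ := exists_finite_orbit_representatives hT hclosed htransB x
  have hx : ∀ v : V, ∃ g ∈ G, g v = x := fun v => by
    obtain ⟨g, hg⟩ := htransV.exists_smul_eq v x
    exact ⟨g.1, g.2, hg⟩
  choose γ hγG hγ using hx
  -- c v is the type of p as seen from v, after v is moved to x. Vertices of equal type are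
  -- equivalent under the stabilizer of p, so that stabilizer has finitely many vertex orbits.
  choose c hct k hkG hkx hkc using fun v => hcov _ (hp.conj (γ v))
  let s : Setoid V :=
    { r := fun v w => ∃ g ∈ G, conjMap g p = p ∧ g v = w
      iseqv :=
        { refl := fun v => ⟨1, one_mem _, rfl, rfl⟩
          symm := by
            rintro v w ⟨g, hg, hgp, rfl⟩
            refine ⟨g⁻¹, inv_mem hg, by rw [conjMap_inv_eq_iff, hgp], ?_⟩
            exact g.symm_apply_apply v
          trans := by
            rintro u v w ⟨g, hg, hgp, rfl⟩ ⟨g', hg', hgp', rfl⟩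
            exact ⟨g' * g, mul_mem hg' hg, by rw [conjMap_mul, hgp, hgp'], rfl⟩ } }
  have hc : ∀ v w, c v = c w → s v w := by
    intro v w hvw
    refine ⟨(γ w)⁻¹ * (k w * ((k v)⁻¹ * γ v)), mul_mem (inv_mem (hγG w))
      (mul_mem (hkG w) (mul_mem (inv_mem (hkG v)) (hγG v))), ?_, ?_⟩
    · rw [conjMap_mul, conjMap_inv_eq_iff, conjMap_mul, conjMap_mul, ← hkc w, ← hvw]
      congr 1
      rw [conjMap_inv_eq_iff, hkc]
    · change (γ w).symm (k w ((k v).symm (γ v v))) = w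
      have : (k v).symm x = x := by
        conv_lhs => rw [← hkx v]
        simp
      rw [hγ, this, hkx, ← hγ w]
      simp
  have : Finite t := ht
  have : Finite (Quotient s) := by
    refine Finite.of_injective (fun a : Quotient s => (⟨c a.out, hct _⟩ : t)) fun a b hab => ?_
    rw [← Quotient.out_eq a, ← Quotient.out_eq b]
    exact Quotient.sound (hc _ _ (congrArg Subtype.val hab))
  let P : Quotient s → Quotient s := Quotient.map p (by
    rintro v _ ⟨g, hg, hgp, rfl⟩
    refine ⟨g, hg, hgp, ?_⟩
    rw [← conjMap_apply_apply, hgp])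
  -- Every vertex is the successor of some neighbour. On a finite quotient surjectivity gives
  -- injectivity, so orbits can be pulled back along iterates of p.
  have hsurj : Function.Surjective P := by
    intro a
    induction a using Quotient.inductionOn with
    | _ v =>
      have hcard : 1 < (T.neighborFinset v).card := by
        rw [card_neighborFinset_eq_degree, hreg v]
        omega
      obtain ⟨w, hw, hne⟩ := Finset.exists_mem_ne hcard (p v)
      rw [mem_neighborFinset] at hw
      refine ⟨Quotient.mk s w, ?_⟩
      change Quotient.mk s (p w) = _
      rw [(hp.2 w v hw.symm).mpr (Ne.symm hne)]
  have hinj : Function.Injective P := Finite.injective_iff_surjective.mpr hsurj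
  have hiter : ∀ (n : ℕ) (v : V), P^[n] (Quotient.mk s v) = Quotient.mk s (p^[n] v) := by
    intro n
    induction n with
    | zero => exact fun _ => rfl
    | succ n ih =>
      intro v
      rw [Function.iterate_succ_apply, Function.iterate_succ_apply, ← ih]
      rfl
  have : Quotient.mk s v = Quotient.mk s w := by
    apply hinj.iterate n
    rw [hiter, hiter, h]
  exact Quotient.exact this

/-- A closed group of automorphisms of a regular tree that is transitive on vertices and on the
boundary is transitive on pairs of vertices at any given distance. -/
lemma exists_map_pair_of_dist_eq [T.LocallyFinite] (hT : T.IsTree) {q : ℕ} (hq : 2 ≤ q)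
    (hreg : T.IsRegularOfDegree (q + 1)) {G : Subgroup (T ≃g T)}
    (hclosed : IsClosed (G : Set (T ≃g T))) (htransV : MulAction.IsPretransitive G V)
    (htransB : MulAction.IsPretransitive G (TreeBoundary T)) {x y x' y' : V}
    (h : T.dist x y = T.dist x' y') : ∃ g ∈ G, g x = x' ∧ g y = y' := by
  classical
  obtain ⟨⟨γ, hγ⟩, hγx : γ x = x'⟩ := htransV.exists_smul_eq x x'
  rw [← hT.connected.dist_map γ, hγx] at h
  suffices hsuff : ∀ a b, T.dist a x' = T.dist b x' → ∃ g ∈ G, g a = b ∧ g x' = x' by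
    obtain ⟨g, hg, hg1, hg2⟩ := hsuff (γ y) y' (by rw [dist_comm, h, dist_comm])
    exact ⟨g * γ, mul_mem hg hγ, (congrArg g hγx).trans hg2, hg1⟩
  intro a b hab
  -- At most one neighbour of x' leads towards a and one towards b; as q + 1 ≥ 3, some neighbour
  -- leads away from both. An end in that direction has x' as the common n-th successor of a and b,
  -- where n is their distance to x'.
  have hex : ∃ z ∈ T.neighborFinset x', T.dist a z = T.dist a x' + 1 ∧
      T.dist b z = T.dist b x' + 1 := by
    have hcard : ∀ c, ((T.neighborFinset x').filter
        fun z => T.dist c x' = T.dist c z + 1).card ≤ 1 := by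
      intro c
      rw [Finset.card_le_one]
      intro z hz z' hz'
      rw [Finset.mem_filter, mem_neighborFinset] at hz hz'
      exact hT.closer_unique hz.1 hz'.1 hz.2 hz'.2
    by_contra! hcon
    have hsub : T.neighborFinset x' ⊆
        ((T.neighborFinset x').filter fun z => T.dist a x' = T.dist a z + 1) ∪
        ((T.neighborFinset x').filter fun z => T.dist b x' = T.dist b z + 1) := by
      intro z hz
      have h1 := hcon z hz
      simp only [Finset.mem_union, Finset.mem_filter, hz, true_and]
      rw [mem_neighborFinset] at hz
      have h2 := hT.dist_eq_dist_add_one_of_adj a hz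
      have h3 := hT.dist_eq_dist_add_one_of_adj b hz
      tauto
    have h1 := (Finset.card_le_card hsub).trans (Finset.card_union_le _ _)
    rw [card_neighborFinset_eq_degree, hreg x'] at h1
    have h2 := hcard a
    have h3 := hcard b
    omega
  obtain ⟨z, hz, hza, hzb⟩ := hex
  rw [mem_neighborFinset] at hz
  obtain ⟨p, hp, rfl⟩ := hT.exists_isEndMap (by omega) hreg hz
  have h1 := hp.iterate_dist_add_one hT rfl hza
  have h2 := hp.iterate_dist_add_one hT rfl hzb
  rw [← hab] at h2
  obtain ⟨g, hg, hgp, hgab⟩ := hp.exists_of_iterate_eq hT (by omega) hreg hclosed htransV htransB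
    (h1.trans h2.symm)
  refine ⟨g, hg, hgab, ?_⟩
  conv_lhs => rw [← h1]
  conv_rhs => rw [← h2, ← hgab, ← hgp]
  rw [conjMap_iterate]
  simp

end Topology

end SimpleGraph

/-! ### Growth argument and functions of the distance -/

/-- A sequence of polynomial growth whose squares are dominated by later terms of at
most double index is bounded by one. -/
lemma le_one_of_sq_le_of_growth {β : ℕ → ℝ}
    (hgrow : ∀ n, β n ≤ ((n : ℝ) + 1) ^ 2) (hsq : ∀ n, ∃ k ≤ 2 * n, β n ^ 2 ≤ β k) (n : ℕ) :
    β n ≤ 1 := by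
  -- Iterating the squaring inequality j times at most doubles the index each time, so β n to the
  -- power 2^j is only quadratic in 2^j; this excludes β n > 1.
  have key : ∀ j n : ℕ, β n ^ 2 ^ j ≤ ((2 ^ j : ℕ) * (n : ℝ) + 1) ^ 2 := by
    intro j
    induction j with
    | zero => intro n; simpa using hgrow n
    | succ j ih =>
      intro n
      obtain ⟨k, hk, hle⟩ := hsq n
      have hk' : (k : ℝ) ≤ 2 * n := by exact_mod_cast hk
      calc β n ^ 2 ^ (j + 1) = (β n ^ 2) ^ 2 ^ j := by rw [← pow_mul, pow_succ' 2 j]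
        _ ≤ β k ^ 2 ^ j := pow_le_pow_left₀ (sq_nonneg _) hle _
        _ ≤ ((2 ^ j : ℕ) * (k : ℝ) + 1) ^ 2 := ih k
        _ ≤ ((2 ^ j : ℕ) * (2 * n : ℝ) + 1) ^ 2 := by gcongr
        _ = ((2 ^ (j + 1) : ℕ) * (n : ℝ) + 1) ^ 2 := by push_cast; ring
  by_contra! hr
  have hlim := (tendsto_pow_const_div_const_pow_of_one_lt 2 hr).comp
    (tendsto_pow_atTop_atTop_of_one_lt (r := 2) one_lt_two)
  have hlim' := hlim.const_mul (((n : ℝ) + 1) ^ 2)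
  rw [mul_zero] at hlim'
  obtain ⟨j, hj⟩ := (hlim'.eventually (gt_mem_nhds zero_lt_one)).exists
  simp only [Function.comp_apply] at hj
  have hpos : 0 < β n ^ 2 ^ j := by positivity
  rw [← mul_div_assoc, div_lt_one hpos] at hj
  have h1 := key j n
  have h2 : (1 : ℝ) ≤ (2 ^ j : ℕ) := by exact_mod_cast Nat.one_le_two_pow
  have h3 : ((2 ^ j : ℕ) * (n : ℝ) + 1) ^ 2 ≤ ((2 ^ j : ℕ) * ((n : ℝ) + 1)) ^ 2 := by
    gcongr
    linarith
  rw [mul_pow] at h3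
  linarith

/-- A function of pairs that only depends on their image under `d` factors through `d`. -/
lemma exists_eq_comp_of_forall_eq {V α : Type*} [Inhabited α] (d : V → V → ℕ) (M : V → V → α)
    (h : ∀ x y x' y', d x y = d x' y' → M x y = M x' y') :
    ∃ N : ℕ → α, ∀ x y, M x y = N (d x y) := by
  have hf : Function.FactorsThrough (fun p : V × V => M p.1 p.2) (fun p : V × V => d p.1 p.2) :=
    fun p p' hp => h _ _ _ _ hp
  exact ⟨Function.extend (fun p : V × V => d p.1 p.2) (fun p : V × V => M p.1 p.2) default,
    fun x y => (hf.extend_apply default (x, y)).symm⟩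

namespace SimpleGraph

/-! ### Sums over spheres -/

section SphereSums

variable {V : Type u} {T : SimpleGraph V} [T.LocallyFinite]

lemma Connected.sum_distSphere_map (hT : T.Connected) (g : T ≃g T) (f : ℕ → ℝ) (x y : V)
    (n : ℕ) : ∑ t ∈ T.distSphere (g y) n, f (T.dist (g x) t) =
      ∑ t ∈ T.distSphere y n, f (T.dist x t) := by
  symm
  refine Finset.sum_bij (fun z _ => g z) ?_ (fun _ _ _ _ h => g.injective h) ?_ ?_
  · intro z hz
    rw [hT.mem_distSphere] at hz ⊢
    rw [hT.dist_map, hz]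
  · intro z hz
    refine ⟨g.symm z, ?_, by simp⟩
    rw [hT.mem_distSphere] at hz ⊢
    rw [← hT.dist_map g]
    simpa using hz
  · intro z _
    rw [hT.dist_map]

namespace IsDistTransitive

lemma sum_distSphere_eq (hdt : T.IsDistTransitive) (hT : T.Connected) (f : ℕ → ℝ)
    {x y x' y' : V} (h : T.dist x y = T.dist x' y') (n : ℕ) :
    ∑ t ∈ T.distSphere y n, f (T.dist x t) = ∑ t ∈ T.distSphere y' n, f (T.dist x' t) := by
  obtain ⟨g, rfl, rfl⟩ := hdt _ _ _ _ h
  rw [hT.sum_distSphere_map]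

lemma card_distSphere_eq (hdt : T.IsDistTransitive) (hT : T.Connected) (x y : V) (n : ℕ) :
    (T.distSphere x n).card = (T.distSphere y n).card := by
  obtain ⟨g, rfl, -⟩ := hdt x x y y (by simp)
  rw [hT.card_distSphere_map]

/-- The two-step sphere sum is a nonnegative combination of sphere sums. -/
lemma exists_sum_distSphere_distSphere (hdt : T.IsDistTransitive) (hT : T.Connected) (n : ℕ) :
    ∃ N : ℕ → ℕ, ∀ (φ : V → ℝ) (y : V),
      ∑ t ∈ T.distSphere y n, ∑ s ∈ T.distSphere t n, φ s =
        ∑ k ∈ Finset.range (2 * n + 1), N k * ∑ s ∈ T.distSphere y k, φ s := by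
  classical
  -- N k counts the t at distance n from both y and s when d(y, s) = k; by the triangle inequality
  -- only k ≤ 2n occurs.
  obtain ⟨N, hN⟩ := exists_eq_comp_of_forall_eq T.dist
    (fun y s => ((T.distSphere y n).filter fun t => T.dist t s = n).card) (by
      intro x y x' y' h
      obtain ⟨g, rfl, rfl⟩ := hdt _ _ _ _ h
      refine Finset.card_bij (fun z _ => g z) ?_ (fun _ _ _ _ h => g.injective h) ?_
      · intro z hz
        rw [Finset.mem_filter, hT.mem_distSphere] at hz ⊢
        rwa [hT.dist_map, hT.dist_map]
      · intro z hz
        refine ⟨g.symm z, ?_, by simp⟩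
        rw [Finset.mem_filter, hT.mem_distSphere] at hz ⊢
        rw [← hT.dist_map g, ← hT.dist_map g (g.symm z)]
        simpa using hz)
  refine ⟨N, fun φ y => ?_⟩
  set B := (Finset.range (2 * n + 1)).biUnion fun k => T.distSphere y k with hB
  have h1 : ∀ t ∈ T.distSphere y n, ∑ s ∈ T.distSphere t n, φ s =
      ∑ s ∈ B, if T.dist t s = n then φ s else 0 := by
    intro t ht
    rw [← Finset.sum_filter]
    congr 1
    ext s
    rw [hT.mem_distSphere] at ht
    simp only [hB, Finset.mem_filter, Finset.mem_biUnion, hT.mem_distSphere, Finset.mem_range]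
    refine ⟨fun h => ⟨⟨T.dist y s, ?_, rfl⟩, h⟩, fun h => h.2⟩
    have := hT.dist_triangle (u := y) (v := t) (w := s)
    omega
  have hdisj : (↑(Finset.range (2 * n + 1)) : Set ℕ).PairwiseDisjoint
      fun k => T.distSphere y k := by
    intro k _ l _ hkl
    rw [Function.onFun, Finset.disjoint_left]
    intro s hs hs'
    rw [hT.mem_distSphere] at hs hs'
    exact hkl (hs.symm.trans hs')
  rw [Finset.sum_congr rfl h1, Finset.sum_comm, hB, Finset.sum_biUnion hdisj]
  refine Finset.sum_congr rfl fun k _ => ?_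
  rw [Finset.mul_sum]
  refine Finset.sum_congr rfl fun s hs => ?_
  rw [hT.mem_distSphere] at hs
  rw [← Finset.sum_filter, Finset.sum_const, nsmul_eq_mul, hN y s, hs]

end IsDistTransitive

end SphereSums

/-! ### The contraction estimate and the recurrence for ψ -/

section ConditionallyNegative

variable {V : Type u} {H : Type v} [NormedAddCommGroup H]

open scoped InnerProductSpace

variable {T : SimpleGraph V} {F : V → H} {ψ : ℕ → ℝ}

lemma Connected.le_sq_mul_of_norm_sub_sq (hT : T.Connected)
    (hF : ∀ x y, ‖F x - F y‖ ^ 2 = ψ (T.dist x y)) (x y : V) :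
    ψ (T.dist x y) ≤ (T.dist x y : ℝ) ^ 2 * ψ 1 := by
  have key : ∀ {x y : V} (p : T.Walk x y), ‖F x - F y‖ ≤ p.length * √(ψ 1) := by
    intro x y p
    induction p with
    | nil => simp
    | @cons x z y h p ih =>
      have h1 : ‖F x - F z‖ = √(ψ 1) := by
        rw [← dist_eq_one_iff_adj.mpr h, ← hF, Real.sqrt_sq (norm_nonneg _)]
      have h2 := norm_sub_le_norm_sub_add_norm_sub (F x) (F z) (F y)
      rw [Walk.length_cons]
      push_cast
      linarith
  obtain ⟨p, hp⟩ := hT.exists_walk_length_eq_dist x y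
  -- An edge is needed to know ψ 1 ≥ 0; the trivial walk is treated apart.
  rcases p with _ | ⟨h, p⟩
  · rw [← hF]
    simp
  · rename_i z
    have hψ : 0 ≤ ψ 1 := by
      rw [← dist_eq_one_iff_adj.mpr h, ← hF]
      positivity
    have h1 := key (Walk.cons h p)
    rw [hp] at h1
    calc ψ (T.dist x y) = ‖F x - F y‖ ^ 2 := (hF x y).symm
      _ ≤ (T.dist x y * √(ψ 1)) ^ 2 := pow_le_pow_left₀ (norm_nonneg _) h1 2
      _ = _ := by rw [mul_pow, Real.sq_sqrt hψ]

variable [InnerProductSpace ℝ H]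

/-- Polarization: equal cardinalities cancel the terms in ‖F z‖², so only mutual distances remain.
-/
lemma inner_sum_sub_sum (F : V → H) {A B C D : Finset V} (hAB : A.card = B.card)
    (hCD : C.card = D.card) :
    ⟪∑ z ∈ A, F z - ∑ z ∈ B, F z, ∑ t ∈ C, F t - ∑ t ∈ D, F t⟫_ℝ =
      (∑ t ∈ D, ∑ z ∈ A, ‖F z - F t‖ ^ 2 + ∑ t ∈ C, ∑ z ∈ B, ‖F z - F t‖ ^ 2
        - ∑ t ∈ C, ∑ z ∈ A, ‖F z - F t‖ ^ 2 - ∑ t ∈ D, ∑ z ∈ B, ‖F z - F t‖ ^ 2) / 2 := by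
  have key : ∀ X Y : Finset V, ∑ t ∈ Y, ∑ z ∈ X, ‖F z - F t‖ ^ 2 =
      Y.card * ∑ z ∈ X, ‖F z‖ ^ 2 + X.card * ∑ t ∈ Y, ‖F t‖ ^ 2
        - 2 * ⟪∑ z ∈ X, F z, ∑ t ∈ Y, F t⟫_ℝ := by
    intro X Y
    simp only [norm_sub_sq_real, Finset.sum_add_distrib, Finset.sum_sub_distrib, Finset.sum_const,
      nsmul_eq_mul, ← Finset.mul_sum, sum_inner, inner_sum]
    ring
  rw [key, key, key, key, inner_sub_left, inner_sub_right, inner_sub_right, hAB, hCD]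
  ring

variable [T.LocallyFinite]

/-- Sphere means are contractions for the Dirichlet form. -/
lemma IsDistTransitive.abs_inner_le (hdt : T.IsDistTransitive) (hT : T.Connected)
    (hF : ∀ x y, ‖F x - F y‖ ^ 2 = ψ (T.dist x y)) {x y : V} (hxy : T.Adj x y)
    (hpos : ∀ n, 0 < (T.distSphere x n).card) (n : ℕ) :
    |⟪F x - F y, ∑ z ∈ T.distSphere x n, F z - ∑ z ∈ T.distSphere y n, F z⟫_ℝ| ≤
      (T.distSphere x n).card * ψ 1 ∧
    ⟪F x - F y, ∑ z ∈ T.distSphere x n, F z - ∑ z ∈ T.distSphere y n, F z⟫_ℝ =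
      ∑ t ∈ T.distSphere x n, ψ (T.dist y t) - (T.distSphere x n).card * ψ n := by
  set σ : ℕ → ℝ := fun n => (T.distSphere x n).card with hσ
  set v : ℕ → H := fun n => ∑ z ∈ T.distSphere x n, F z - ∑ z ∈ T.distSphere y n, F z with hv
  set a : ℕ → ℝ := fun n => ⟪F x - F y, v n⟫_ℝ with ha
  have hcard : ∀ n, (T.distSphere x n).card = (T.distSphere y n).card :=
    fun n => hdt.card_distSphere_eq hT x y n
  have hdist : T.dist x y = T.dist y x := dist_comm
  -- Distance transitivity allows the two vertices to be exchanged.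
  have hsymm : ∀ n (x y : V), ∑ t ∈ T.distSphere y n, ψ (T.dist x t) =
      ∑ t ∈ T.distSphere x n, ψ (T.dist y t) :=
    fun n x y => hdt.sum_distSphere_eq hT ψ dist_comm n
  have hself : ∀ n (x : V), ∑ t ∈ T.distSphere x n, ψ (T.dist x t) =
      (T.distSphere x n).card * ψ n := by
    intro n x
    rw [Finset.sum_congr rfl fun t ht => by rw [hT.mem_distSphere.mp ht], Finset.sum_const,
      nsmul_eq_mul]
  have ha1 : ∀ n, a n = (2 * ∑ t ∈ T.distSphere y n, ψ (T.dist x t)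
      - ∑ t ∈ T.distSphere x n, ψ (T.dist x t) - ∑ t ∈ T.distSphere y n, ψ (T.dist y t)) / 2 := by
    intro n
    have h1 := inner_sum_sub_sum F (A := {x}) (B := {y}) rfl (hcard n)
    simp only [Finset.sum_singleton, hF] at h1
    rw [ha]
    simp only [hv]
    rw [h1, hsymm n y x]
    ring
  have ha2 : ∀ n, a n = ∑ t ∈ T.distSphere x n, ψ (T.dist y t) - σ n * ψ n := by
    intro n
    rw [ha1, hself, hself, ← hcard, hsymm n x y]
    ring
  refine ⟨?_, ha2 n⟩
  have hψ1 : ψ 1 = ‖F x - F y‖ ^ 2 := by rw [hF, dist_eq_one_iff_adj.mpr hxy]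
  have hψ1' : 0 ≤ ψ 1 := by rw [hψ1]; positivity
  have hψ0 : ∀ x y, 0 ≤ ψ (T.dist x y) := fun x y => by rw [← hF]; positivity
  have hgrow : ∀ n, |a n| ≤ σ n * (((n : ℝ) + 1) ^ 2 * ψ 1) := by
    intro n
    have h1 : ∑ t ∈ T.distSphere x n, ψ (T.dist y t) ≤ σ n * (((n : ℝ) + 1) ^ 2 * ψ 1) := by
      rw [hσ, ← nsmul_eq_mul]
      refine Finset.sum_le_card_nsmul _ _ _ fun t ht => ?_
      rw [hT.mem_distSphere] at ht
      have h2 := hT.dist_triangle (u := y) (v := x) (w := t)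
      rw [ht, dist_eq_one_iff_adj.mpr hxy.symm] at h2
      have h3 : (T.dist y t : ℝ) ≤ n + 1 := by
        have : T.dist y t ≤ n + 1 := by omega
        exact_mod_cast this
      exact (hT.le_sq_mul_of_norm_sub_sq hF y t).trans (by gcongr)
    have h1' : 0 ≤ ∑ t ∈ T.distSphere x n, ψ (T.dist y t) :=
      Finset.sum_nonneg fun t _ => hψ0 _ _
    have h2 : σ n * ψ n ≤ σ n * (((n : ℝ) + 1) ^ 2 * ψ 1) := by
      rw [hσ, ← hself, ← nsmul_eq_mul]
      refine Finset.sum_le_card_nsmul _ _ _ fun t ht => ?_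
      rw [hT.mem_distSphere] at ht
      refine (hT.le_sq_mul_of_norm_sub_sq hF x t).trans ?_
      rw [ht]
      gcongr
      linarith
    have h2' : 0 ≤ σ n * ψ n := by
      rw [hσ, ← hself]
      exact Finset.sum_nonneg fun t _ => hψ0 _ _
    rw [ha2, abs_le]
    constructor <;> linarith
  rcases hψ1'.eq_or_lt with h0 | h0
  · have := hgrow n
    rw [← h0] at this ⊢
    simpa using this
  have hσpos : ∀ n, 0 < σ n := fun n => Nat.cast_pos.mpr (hpos n)
  have hsq : ∀ n, ∃ k ≤ 2 * n, (|a n| / (σ n * ψ 1)) ^ 2 ≤ |a k| / (σ k * ψ 1) := by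
    intro n
    obtain ⟨N, hN⟩ := hdt.exists_sum_distSphere_distSphere hT n
    have hconv : ∀ x y : V, ∑ t ∈ T.distSphere y n, ∑ z ∈ T.distSphere x n, ψ (T.dist z t) =
        ∑ k ∈ Finset.range (2 * n + 1), N k * ∑ s ∈ T.distSphere y k, ψ (T.dist x s) := by
      intro x y
      rw [← hN]
      refine Finset.sum_congr rfl fun t _ => ?_
      rw [hsymm n x t]
      exact Finset.sum_congr rfl fun z _ => by rw [dist_comm]
    have hb : ‖v n‖ ^ 2 = ∑ k ∈ Finset.range (2 * n + 1), N k * a k := by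
      rw [← real_inner_self_eq_norm_sq, hv]
      simp only
      rw [inner_sum_sub_sum F (hcard n) (hcard n)]
      simp only [hF, hconv, ha1]
      rw [← Finset.sum_add_distrib, ← Finset.sum_sub_distrib, ← Finset.sum_sub_distrib,
        Finset.sum_div]
      refine Finset.sum_congr rfl fun k _ => ?_
      rw [hsymm k y x]
      ring
    have hσsq : ∑ k ∈ Finset.range (2 * n + 1), N k * σ k = σ n ^ 2 := by
      have := hN (fun _ => 1) x
      simp only [Finset.sum_const, nsmul_eq_mul, mul_one] at this
      rw [← this, Finset.sum_congr rfl fun t _ => by rw [hdt.card_distSphere_eq hT t x n],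
        Finset.sum_const, nsmul_eq_mul, sq]
    -- ‖v n‖² is the combination of the a k with weights N k, and the σ k with the same weights sum
    -- to σ n². The largest normalized term therefore bounds ‖v n‖², and Cauchy-Schwarz finishes.
    obtain ⟨k, hk, hmax⟩ := Finset.exists_max_image (Finset.range (2 * n + 1))
      (fun k => |a k| / (σ k * ψ 1)) ⟨0, by simp⟩
    refine ⟨k, by simpa [Nat.lt_succ_iff] using hk, ?_⟩
    set M := |a k| / (σ k * ψ 1) with hM
    have h1 : ‖v n‖ ^ 2 ≤ σ n ^ 2 * (M * ψ 1) := by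
      rw [hb, ← hσsq, Finset.sum_mul]
      refine Finset.sum_le_sum fun j hj => ?_
      have := hmax j hj
      rw [div_le_iff₀ (mul_pos (hσpos j) h0)] at this
      calc N j * a j ≤ N j * (M * (σ j * ψ 1)) := by
            gcongr
            exact (le_abs_self _).trans this
        _ = _ := by ring
    have h2 : |a n| ^ 2 ≤ ψ 1 * ‖v n‖ ^ 2 := by
      rw [hψ1, ← mul_pow]
      exact pow_le_pow_left₀ (abs_nonneg _) (abs_real_inner_le_norm _ _) 2
    rw [div_pow, div_le_iff₀ (by have := hσpos n; positivity)]
    calc |a n| ^ 2 ≤ ψ 1 * (σ n ^ 2 * (M * ψ 1)) := h2.trans (by gcongr)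
      _ = _ := by ring
  have hfin := le_one_of_sq_le_of_growth (β := fun n => |a n| / (σ n * ψ 1))
    (fun n => by
      rw [div_le_iff₀ (mul_pos (hσpos n) h0)]
      exact (hgrow n).trans_eq (by ring)) hsq n
  rwa [div_le_one (mul_pos (hσpos n) h0)] at hfin

lemma IsDistTransitive.recurrence_le (hdt : T.IsDistTransitive) (hT : T.IsTree) {q : ℕ}
    (hq : 1 ≤ q) (hreg : T.IsRegularOfDegree (q + 1))
    (hF : ∀ x y, ‖F x - F y‖ ^ 2 = ψ (T.dist x y)) (n : ℕ) :
    q * ψ (n + 2) + ψ n ≤ (q + 1) * (ψ (n + 1) + ψ 1) := by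
  obtain ⟨x⟩ := hT.connected.nonempty
  obtain ⟨y, hy⟩ := hT.exists_dist_eq hq hreg x 1
  rw [dist_eq_one_iff_adj] at hy
  have hpos : ∀ n, 0 < (T.distSphere x n).card := by
    intro n
    obtain ⟨z, hz⟩ := hT.exists_dist_eq hq hreg x n
    exact Finset.card_pos.mpr ⟨z, hT.connected.mem_distSphere.mpr hz⟩
  obtain ⟨h1, h2⟩ := hdt.abs_inner_le hT.connected hF hy hpos (n + 1)
  have h3 := (le_abs_self _).trans h1
  rw [h2] at h3
  -- The sum is the same for every neighbour of x. Summing over all of them and exchanging sums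
  -- leaves, for each t, one neighbour nearer to t and q farther away.
  have h4 : ((q : ℝ) + 1) * ∑ t ∈ T.distSphere x (n + 1), ψ (T.dist y t) =
      (T.distSphere x (n + 1)).card * (ψ n + q * ψ (n + 2)) := by
    calc _ = ∑ y' ∈ T.neighborFinset x, ∑ t ∈ T.distSphere x (n + 1), ψ (T.dist y' t) := by
          have hconst : ∀ y' ∈ T.neighborFinset x, ∑ t ∈ T.distSphere x (n + 1), ψ (T.dist y' t) =
              ∑ t ∈ T.distSphere x (n + 1), ψ (T.dist y t) := by
            intro y' hy'
            refine hdt.sum_distSphere_eq hT.connected ψ ?_ _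
            rw [mem_neighborFinset] at hy'
            rw [dist_eq_one_iff_adj.mpr hy'.symm, dist_eq_one_iff_adj.mpr hy.symm]
          rw [Finset.sum_congr rfl hconst, Finset.sum_const, card_neighborFinset_eq_degree, hreg x,
            nsmul_eq_mul, Nat.cast_add, Nat.cast_one]
      _ = ∑ t ∈ T.distSphere x (n + 1), ∑ y' ∈ T.neighborFinset x, ψ (T.dist t y') := by
          rw [Finset.sum_comm]
          simp only [dist_comm]
      _ = _ := by
          rw [Finset.sum_congr rfl fun t ht => hT.sum_neighborFinset_dist hreg ψ
            (dist_comm.trans (hT.connected.mem_distSphere.mp ht)), Finset.sum_const, nsmul_eq_mul]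
  have hσ : (0 : ℝ) < (T.distSphere x (n + 1)).card := by exact_mod_cast hpos (n + 1)
  refine le_of_mul_le_mul_left ?_ hσ
  have hq0 : (0 : ℝ) < (q : ℝ) + 1 := by positivity
  have h5 := mul_le_mul_of_nonneg_left h3 hq0.le
  rw [mul_sub, h4] at h5
  linarith

/-- Expand ‖F y - F z‖² around F x and sum over the neighbours y of x: harmonicity at x kills the
cross terms. -/
lemma IsTree.recurrence_eq_of_sum_eq (hT : T.IsTree) {q : ℕ} (hq : 1 ≤ q)
    (hreg : T.IsRegularOfDegree (q + 1)) (hF : ∀ x y, ‖F x - F y‖ ^ 2 = ψ (T.dist x y))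
    (hharm : ∀ x, ∑ y ∈ T.neighborFinset x, F y = (q + 1) • F x) (n : ℕ) :
    q * ψ (n + 2) + ψ n = (q + 1) * (ψ (n + 1) + ψ 1) := by
  obtain ⟨z⟩ := hT.connected.nonempty
  obtain ⟨x, hx⟩ := hT.exists_dist_eq hq hreg z (n + 1)
  have h1 : ∑ y ∈ T.neighborFinset x, (F y - F x) = 0 := by
    rw [Finset.sum_sub_distrib, hharm, Finset.sum_const, card_neighborFinset_eq_degree, hreg x,
      sub_self]
  have h2 : ∀ y ∈ T.neighborFinset x,
      ψ (T.dist z y) = (ψ 1 + ψ (n + 1)) + 2 * ⟪F y - F x, F x - F z⟫_ℝ := by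
    intro y hy
    rw [mem_neighborFinset] at hy
    rw [dist_comm, ← hF, ← sub_add_sub_cancel (F y) (F x) (F z), norm_add_sq_real, hF, hF,
      dist_eq_one_iff_adj.mpr hy.symm, dist_comm (u := x), hx]
    ring
  have h3 := hT.sum_neighborFinset_dist hreg ψ hx
  rw [Finset.sum_congr rfl h2, Finset.sum_add_distrib, ← Finset.mul_sum, ← sum_inner, h1,
    inner_zero_left, Finset.sum_const, card_neighborFinset_eq_degree, hreg x, nsmul_eq_mul] at h3
  push_cast at h3
  linarith

end ConditionallyNegative

end SimpleGraph

/-! ### Solving the recurrence and bounding equivariant maps -/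

/-- The increments δ of ψ satisfy q δ(n+1) ≤ δ(n) + (q+1) ψ 1. The fixed point (q+1) ψ 1 / (q-1)
gives the slope, and the initial gap 2 ψ 1 / (q-1) decays geometrically with ratio 1/q. -/
lemma le_of_recurrence_le {q : ℝ} (hq : 1 < q) {ψ : ℕ → ℝ} (h0 : ψ 0 = 0)
    (h : ∀ n, q * ψ (n + 2) + ψ n ≤ (q + 1) * (ψ (n + 1) + ψ 1)) (n : ℕ) :
    ψ n ≤ (q + 1) * ψ 1 / (q - 1) * n - 2 * q * ψ 1 / (q - 1) ^ 2
      + 2 * q * ψ 1 / (q - 1) ^ 2 * (q ^ n)⁻¹ := by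
  have hq1 : q - 1 ≠ 0 := by linarith
  have hq0 : 0 < q := by linarith
  have hinc : ∀ n, ψ (n + 1) - ψ n ≤ (q + 1) * ψ 1 / (q - 1) - 2 * ψ 1 / (q - 1) * (q ^ n)⁻¹ := by
    intro n
    induction n with
    | zero =>
      rw [h0]
      refine le_of_eq ?_
      field_simp
      ring
    | succ n ih =>
      refine le_of_mul_le_mul_left ?_ hq0
      calc q * (ψ (n + 1 + 1) - ψ (n + 1)) ≤ (ψ (n + 1) - ψ n) + (q + 1) * ψ 1 := by
            linarith [h n]
        _ ≤ (q + 1) * ψ 1 / (q - 1) - 2 * ψ 1 / (q - 1) * (q ^ n)⁻¹ + (q + 1) * ψ 1 := by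
            gcongr
        _ = _ := by
            rw [pow_succ]
            field_simp
            ring
  induction n with
  | zero => simp [h0]
  | succ n ih =>
    have h1 := hinc n
    have h2 : (q + 1) * ψ 1 / (q - 1) * ((n + 1 : ℕ) : ℝ) - 2 * q * ψ 1 / (q - 1) ^ 2
        + 2 * q * ψ 1 / (q - 1) ^ 2 * (q ^ (n + 1))⁻¹ =
        ((q + 1) * ψ 1 / (q - 1) * n - 2 * q * ψ 1 / (q - 1) ^ 2
          + 2 * q * ψ 1 / (q - 1) ^ 2 * (q ^ n)⁻¹)
        + ((q + 1) * ψ 1 / (q - 1) - 2 * ψ 1 / (q - 1) * (q ^ n)⁻¹) := by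
      push_cast
      rw [pow_succ]
      field_simp
      ring
    rw [h2]
    linarith

/-- The inequality is linear in ψ, so it applies to both ψ and -ψ. -/
lemma eq_of_recurrence_eq {q : ℝ} (hq : 1 < q) {ψ : ℕ → ℝ} (h0 : ψ 0 = 0)
    (h : ∀ n, q * ψ (n + 2) + ψ n = (q + 1) * (ψ (n + 1) + ψ 1)) (n : ℕ) :
    ψ n = (q + 1) * ψ 1 / (q - 1) * n - 2 * q * ψ 1 / (q - 1) ^ 2
      + 2 * q * ψ 1 / (q - 1) ^ 2 * (q ^ n)⁻¹ := by
  refine le_antisymm (le_of_recurrence_le hq h0 (fun n => (h n).le) n) ?_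
  have h1 := le_of_recurrence_le hq (ψ := fun n => -ψ n) (by simp [h0])
    (fun n => by linarith [h n]) n
  rw [← neg_le_neg_iff]
  refine h1.trans_eq ?_
  ring

namespace SimpleGraph

variable {𝕜 : Type w} [RCLike 𝕜] {V : Type u} {T : SimpleGraph V} {H : Type v}
  [NormedAddCommGroup H] [InnerProductSpace 𝕜 H]

lemma IsEquivariantMap.norm_sub_eq {G : Subgroup (T ≃g T)} {α : G →* (H ≃ᵃⁱ[𝕜] H)} {F : V → H}
    (hF : IsEquivariantMap α F) {g : T ≃g T} (hg : g ∈ G) (x y : V) :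
    ‖F (g x) - F (g y)‖ = ‖F x - F y‖ := by
  have h1 : ∀ x, F (g x) = α ⟨g, hg⟩ (F x) := fun x => hF ⟨g, hg⟩ x
  rw [h1, h1, ← dist_eq_norm, AffineIsometryEquiv.dist_map, dist_eq_norm]

lemma IsHarmonicMap.sum_eq [T.LocallyFinite] {q : ℕ} (hreg : T.IsRegularOfDegree (q + 1))
    {F : V → H} (hF : IsHarmonicMap 𝕜 T F) (x : V) :
    ∑ y ∈ T.neighborFinset x, F y = (q + 1) • F x := by
  have h1 := sub_eq_zero.mp (hF x)
  have h2 : ((q + 1 : ℕ) : 𝕜) ≠ 0 := Nat.cast_ne_zero.mpr (Nat.succ_ne_zero q)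
  rw [hreg x, inv_smul_eq_iff₀ h2] at h1
  rw [h1, Nat.cast_smul_eq_nsmul]

/-- The growth bound for equivariant maps, with equality for harmonic maps. -/
lemma IsEquivariantMap.norm_sq_le [T.LocallyFinite] {G : Subgroup (T ≃g T)}
    {α : G →* (H ≃ᵃⁱ[𝕜] H)} {F : V → H} (hF : IsEquivariantMap α F) (hT : T.IsTree) {q : ℕ}
    (hq : 2 ≤ q) (hreg : T.IsRegularOfDegree (q + 1))
    (hpair : ∀ x y x' y', T.dist x y = T.dist x' y' → ∃ g ∈ G, g x = x' ∧ g y = y')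
    {x₀ x₁ : V} (h0 : F x₀ = 0) (h01 : T.Adj x₀ x₁) {A B : ℝ}
    (hA : A = ((q : ℝ) + 1) * ‖F x₁‖ ^ 2 / ((q : ℝ) - 1))
    (hB : B = 2 * (q : ℝ) * ‖F x₁‖ ^ 2 / ((q : ℝ) - 1) ^ 2) :
    (∀ x : V, ‖F x‖ ^ 2 ≤ A * (T.dist x x₀ : ℝ) - B + B * ((q : ℝ) ^ T.dist x x₀)⁻¹) ∧
    (IsHarmonicMap 𝕜 T F →
      ∀ x : V, ‖F x‖ ^ 2 = A * (T.dist x x₀ : ℝ) - B + B * ((q : ℝ) ^ T.dist x x₀)⁻¹) := by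
  -- Only norms matter, so the complex case reduces to the underlying real Hilbert space.
  let _ : InnerProductSpace ℝ H := InnerProductSpace.rclikeToReal 𝕜 H
  obtain ⟨ψ, hψ⟩ := exists_eq_comp_of_forall_eq T.dist (fun x y => ‖F x - F y‖ ^ 2) (by
    intro x y x' y' h
    obtain ⟨g, hg, rfl, rfl⟩ := hpair _ _ _ _ h
    simp only [hF.norm_sub_eq hg])
  have hdt : T.IsDistTransitive := fun x y x' y' h => by
    obtain ⟨g, -, hg⟩ := hpair x y x' y' h
    exact ⟨g, hg⟩
  have hq1 : (1 : ℝ) < q := by exact_mod_cast hq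
  have hψ0 : ψ 0 = 0 := by
    have := hψ x₀ x₀
    simpa using this.symm
  have hψ1 : ψ 1 = ‖F x₁‖ ^ 2 := by
    rw [← dist_eq_one_iff_adj.mpr h01.symm, ← hψ, h0, sub_zero]
  have hψx : ∀ x, ‖F x‖ ^ 2 = ψ (T.dist x x₀) := fun x => by rw [← hψ, h0, sub_zero]
  subst hA hB
  rw [← hψ1]
  simp only [hψx]
  exact ⟨fun x => le_of_recurrence_le hq1 hψ0 (hdt.recurrence_le hT (by omega) hreg hψ) _,
    fun hh x => eq_of_recurrence_eq hq1 hψ0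
      (hT.recurrence_eq_of_sum_eq (by omega) hreg hψ (hh.sum_eq hreg)) _⟩

end SimpleGraph

/-! ### Permutation representations on ℓ² -/

section Permutation

variable {𝕜 : Type w} [RCLike 𝕜] {ι : Type u}

/-- The isometry of `ℓ²(ι)` induced by a permutation of `ι`. -/
noncomputable def lpPermute (e : Equiv.Perm ι) :
    lp (fun _ : ι => 𝕜) 2 ≃ₗᵢ[𝕜] lp (fun _ : ι => 𝕜) 2 where
  toFun f := ⟨fun i => f (e.symm i), by
    have h := (lp.memℓp f).summable (by norm_num)
    exact memℓp_gen (e.symm.summable_iff.mpr h)⟩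
  invFun f := ⟨fun i => f (e i), by
    have h := (lp.memℓp f).summable (by norm_num)
    exact memℓp_gen (e.summable_iff.mpr h)⟩
  map_add' _ _ := rfl
  map_smul' _ _ := rfl
  left_inv f := by ext i; simp
  right_inv f := by ext i; simp
  norm_map' f := by
    rw [lp.norm_eq_tsum_rpow (by norm_num), lp.norm_eq_tsum_rpow (by norm_num)]
    congr 1
    exact e.symm.tsum_eq (fun i => ‖f i‖ ^ (2 : ENNReal).toReal)

@[simp]
lemma lpPermute_apply (e : Equiv.Perm ι) (f : lp (fun _ : ι => 𝕜) 2) (i : ι) :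
    lpPermute e f i = f (e.symm i) := rfl

lemma lpPermute_single [DecidableEq ι] (e : Equiv.Perm ι) (i : ι) (a : 𝕜) :
    lpPermute e (lp.single 2 i a) = lp.single 2 (e i) a := by
  ext j
  rw [lpPermute_apply, lp.single_apply, lp.single_apply]
  simp only [Pi.single_apply, Equiv.symm_apply_eq]

end Permutation

namespace SimpleGraph

/-! ### Harmonic functions attached to oriented edges -/

section Height

variable {V : Type u} {T : SimpleGraph V}

open Classical in
/-- The harmonic function of `x` attached to the oriented edge `c` of a `(q + 1)`-regular tree,
which is radial on each side of that edge and odd under reversal of the edge. -/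
noncomputable def edgeHeight (T : SimpleGraph V) (q : ℕ) (x : V) (c : V × V) : ℝ :=
  if T.Adj c.1 c.2 then ((T.dist c.1 x : ℝ) - T.dist c.2 x) *
    ((q : ℝ) + 1 - 2 * ((q : ℝ) ^ min (T.dist c.1 x) (T.dist c.2 x))⁻¹) else 0

lemma edgeHeight_swap (q : ℕ) (x a b : V) :
    T.edgeHeight q x (b, a) = -T.edgeHeight q x (a, b) := by
  by_cases h : T.Adj a b
  · simp only [edgeHeight, h, h.symm, if_true, min_comm (T.dist b x)]
    ring
  · have h' : ¬ T.Adj b a := fun h' => h h'.symm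
    simp [edgeHeight, h, h']

lemma edgeHeight_of_not_adj {q : ℕ} {x : V} {c : V × V} (h : ¬ T.Adj c.1 c.2) :
    T.edgeHeight q x c = 0 := if_neg h

lemma edgeHeight_of_dist_eq {q : ℕ} {x a b : V} (hab : T.Adj a b)
    (h : T.dist a x = T.dist b x + 1) :
    T.edgeHeight q x (a, b) = (q : ℝ) + 1 - 2 * ((q : ℝ) ^ T.dist b x)⁻¹ := by
  rw [edgeHeight, if_pos hab]
  simp only [h]
  rw [min_eq_right (Nat.le_succ _)]
  push_cast
  ring

lemma Connected.edgeHeight_map (hT : T.Connected) (q : ℕ) (g : T ≃g T) (x a b : V) :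
    T.edgeHeight q (g x) (g a, g b) = T.edgeHeight q x (a, b) := by
  simp only [edgeHeight, hT.dist_map]
  have h' : T.Adj (g a) (g b) ↔ T.Adj a b := g.map_rel_iff
  by_cases h : T.Adj a b
  · simp only [h, h'.mpr h, if_true]
  · simp only [h, h'.not.mpr h, if_false]

lemma IsTree.dist_eq_of_adj_of_ne (hT : T.IsTree) {a b x y : V} (hab : T.Adj a b)
    (hxy : T.Adj x y) (hx : T.dist a x = T.dist b x + 1) (hne : ¬ (b = x ∧ a = y)) :
    T.dist a y = T.dist b y + 1 := by
  have h := hT.dist_eq_dist_add_one_of_adj y hab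
  rw [dist_comm (u := y), dist_comm (u := y)] at h
  rcases h with h | h
  · exact h
  · exact absurd (hT.eq_of_dist_lt_of_dist_lt hab hxy hx h) hne

/-- Away from the edge this holds because constants and q^(-n) both solve f(n) + q f(n+2) = (q+1)
f(n+1). At an endpoint the coefficients q + 1 and 2 are tuned so that the value -(q-1) across the
edge balances. -/
lemma IsTree.sum_edgeHeight [T.LocallyFinite] (hT : T.IsTree) {q : ℕ} (hq : 1 ≤ q)
    (hreg : T.IsRegularOfDegree (q + 1)) (x : V) (c : V × V) :
    ∑ y ∈ T.neighborFinset x, T.edgeHeight q y c = (q + 1) * T.edgeHeight q x c := by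
  classical
  have hq0 : (q : ℝ) ≠ 0 := by positivity
  have key : ∀ a b, T.Adj a b → T.dist a x = T.dist b x + 1 →
      ∑ y ∈ T.neighborFinset x, T.edgeHeight q y (a, b) = (q + 1) * T.edgeHeight q x (a, b) := by
    intro a b hab hx
    rw [edgeHeight_of_dist_eq hab hx]
    by_cases hbx : b = x
    · subst hbx
      have hmem : a ∈ T.neighborFinset b := by simpa using hab.symm
      have h1 : T.edgeHeight q a (a, b) = -((q : ℝ) + 1 - 2) := by
        rw [edgeHeight_swap q a b a, edgeHeight_of_dist_eq hab.symm, dist_self]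
        · simp
        · rw [dist_self, dist_eq_one_iff_adj.mpr hab.symm]
      have h2 : ∀ y ∈ (T.neighborFinset b).erase a,
          T.edgeHeight q y (a, b) = (q : ℝ) + 1 - 2 * (q : ℝ)⁻¹ := by
        intro y hy
        rw [Finset.mem_erase, mem_neighborFinset] at hy
        rw [edgeHeight_of_dist_eq hab (hT.dist_eq_of_adj_of_ne hab hy.2 hx
          fun h => hy.1 h.2.symm), dist_eq_one_iff_adj.mpr hy.2, pow_one]
      rw [← Finset.add_sum_erase _ _ hmem, Finset.sum_congr rfl h2, Finset.sum_const,
        Finset.card_erase_of_mem hmem, card_neighborFinset_eq_degree, hreg b, h1, dist_self]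
      simp only [add_tsub_cancel_right, nsmul_eq_mul, pow_zero]
      field_simp
      ring
    · obtain ⟨n, hn⟩ : ∃ n, T.dist b x = n + 1 :=
        Nat.exists_eq_succ_of_ne_zero fun h => hbx (hT.connected.dist_eq_zero_iff.mp h)
      rw [Finset.sum_congr rfl fun y hy => edgeHeight_of_dist_eq hab
          (hT.dist_eq_of_adj_of_ne hab (by simpa using hy) hx fun h => hbx h.1),
        hT.sum_neighborFinset_dist hreg (fun n => (q : ℝ) + 1 - 2 * ((q : ℝ) ^ n)⁻¹) hn, hn]
      field_simp
      ring
  obtain ⟨a, b⟩ := c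
  by_cases hab : T.Adj a b
  · have h := hT.dist_eq_dist_add_one_of_adj x hab
    rw [dist_comm (u := x), dist_comm (u := x)] at h
    rcases h with h | h
    · exact key a b hab h
    · have := key b a hab.symm h
      simp only [edgeHeight_swap q _ a b, Finset.sum_neg_distrib] at this
      linarith
  · simp [edgeHeight_of_not_adj (c := (a, b)) hab]

/-- On one side of the edge only the q^(-n) term varies; crossing the edge costs 2(q-1). In 2q², one
factor q absorbs a step from x to y, the other the passage between endpoints of the edge. -/
lemma IsTree.abs_edgeHeight_sub_le (hT : T.IsTree) {q : ℕ} (hq : 1 ≤ q) {x y : V}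
    (hxy : T.Adj x y) (c : V × V) :
    |T.edgeHeight q y c - T.edgeHeight q x c| ≤ 2 * q ^ 2 * ((q : ℝ) ^ T.dist x c.1)⁻¹ := by
  have hq1 : (1 : ℝ) ≤ q := by exact_mod_cast hq
  have hq0 : (0 : ℝ) < q := by positivity
  have hmono : ∀ {k m n : ℕ}, n ≤ m + k → ((q : ℝ) ^ m)⁻¹ ≤ q ^ k * ((q : ℝ) ^ n)⁻¹ := by
    intro k m n h
    rw [← div_eq_mul_inv, le_div_iff₀ (by positivity), inv_mul_le_iff₀ (by positivity), ← pow_add]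
    exact pow_le_pow_right₀ hq1 h
  have key : ∀ a b, T.Adj a b → T.dist a x = T.dist b x + 1 →
      |T.edgeHeight q y (a, b) - T.edgeHeight q x (a, b)| ≤
        2 * q * ((q : ℝ) ^ T.dist x b)⁻¹ := by
    intro a b hab hx
    by_cases hne : b = x ∧ a = y
    · obtain ⟨rfl, rfl⟩ := hne
      rw [edgeHeight_of_dist_eq hab hx, edgeHeight_swap q a b a, edgeHeight_of_dist_eq hab.symm]
      · simp only [dist_self, pow_zero, inv_one, mul_one]
        rw [abs_le]
        constructor <;> linarith
      · rw [dist_self, dist_eq_one_iff_adj.mpr hab.symm]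
    · rw [edgeHeight_of_dist_eq hab hx,
        edgeHeight_of_dist_eq hab (hT.dist_eq_of_adj_of_ne hab hxy hx hne), dist_comm (u := x)]
      have h1 := hT.dist_eq_dist_add_one_of_adj b hxy
      have h2 := hmono (k := 1) (m := T.dist b y) (n := T.dist b x) (by omega)
      have h3 : ((q : ℝ) ^ T.dist b x)⁻¹ ≤ q * ((q : ℝ) ^ T.dist b x)⁻¹ :=
        le_mul_of_one_le_left (by positivity) hq1
      have h4 : 0 < ((q : ℝ) ^ T.dist b x)⁻¹ := by positivity
      have h5 : 0 < ((q : ℝ) ^ T.dist b y)⁻¹ := by positivity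
      rw [pow_one] at h2
      rw [abs_le]
      constructor <;> linarith
  obtain ⟨a, b⟩ := c
  by_cases hab : T.Adj a b
  · have h := hT.dist_eq_dist_add_one_of_adj x hab
    rw [dist_comm (u := x), dist_comm (u := x)] at h
    rcases h with h | h
    · have h2 := hmono (k := 1) (m := T.dist x b) (n := T.dist x a)
        (by rw [dist_comm (u := x), dist_comm (u := x)]; omega)
      refine (key a b hab h).trans ?_
      calc 2 * (q : ℝ) * ((q : ℝ) ^ T.dist x b)⁻¹
          ≤ 2 * (q : ℝ) * (q ^ 1 * ((q : ℝ) ^ T.dist x a)⁻¹) := by gcongr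
        _ = _ := by ring
    · have h1 := key b a hab.symm h
      simp only [edgeHeight_swap q _ a b, ← neg_sub', abs_neg] at h1
      refine h1.trans ?_
      gcongr
      nlinarith
  · simp only [edgeHeight_of_not_adj (c := (a, b)) hab, sub_self, abs_zero]
    positivity

variable [T.LocallyFinite]

lemma IsTree.summable_pow_dist (hT : T.IsTree) {q : ℕ} (hreg : T.IsRegularOfDegree (q + 1))
    {r : ℝ} (hr0 : 0 ≤ r) (hr : (q + 1) * r < 1) (x : V) :
    Summable fun a => r ^ T.dist x a := by
  classical
  have hgeo : Summable fun k : ℕ => (((q : ℝ) + 1) * r) ^ k :=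
    summable_geometric_of_lt_one (by positivity) hr
  refine summable_of_sum_le (c := ∑' k : ℕ, (((q : ℝ) + 1) * r) ^ k) (fun a => by positivity)
    fun s => ?_
  rw [← Finset.sum_fiberwise_of_maps_to (t := s.image (T.dist x))
    (fun a ha => Finset.mem_image_of_mem _ ha)]
  refine le_trans (Finset.sum_le_sum fun k _ => ?_)
    (hgeo.sum_le_tsum (s.image (T.dist x)) fun k _ => by positivity)
  have hsub : (s.filter fun a => T.dist x a = k) ⊆ T.distSphere x k := fun a ha =>
    hT.connected.mem_distSphere.mpr (Finset.mem_filter.mp ha).2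
  calc ∑ a ∈ s with T.dist x a = k, r ^ T.dist x a
      = ∑ a ∈ s with T.dist x a = k, r ^ k :=
        Finset.sum_congr rfl fun a ha => by rw [(Finset.mem_filter.mp ha).2]
    _ = (s.filter fun a => T.dist x a = k).card * r ^ k := by
        rw [Finset.sum_const, nsmul_eq_mul]
    _ ≤ ((q : ℝ) + 1) ^ k * r ^ k := by
        gcongr
        exact_mod_cast (Finset.card_le_card hsub).trans (hT.connected.card_distSphere_le hreg x k)
    _ = _ := (mul_pow _ _ _).symm

lemma IsTree.memℓp_edgeHeight_sub (𝕜 : Type w) [RCLike 𝕜] (hT : T.IsTree) {q : ℕ} (hq : 2 ≤ q)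
    (hreg : T.IsRegularOfDegree (q + 1)) (x y : V) :
    Memℓp (fun c => ((T.edgeHeight q x c - T.edgeHeight q y c : ℝ) : 𝕜)) 2 := by
  classical
  have hq2 : (2 : ℝ) ≤ q := by exact_mod_cast hq
  have hadj : ∀ x y, T.Adj x y →
      Memℓp (fun c => ((T.edgeHeight q x c - T.edgeHeight q y c : ℝ) : 𝕜)) 2 := by
    intro y x hyx
    refine memℓp_gen ?_
    simp only [ENNReal.toReal_ofNat, Real.rpow_ofNat, RCLike.norm_ofReal, sq_abs]
    have hfib : ∀ a, ∀ b ∉ T.neighborFinset a,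
        (T.edgeHeight q y (a, b) - T.edgeHeight q x (a, b)) ^ 2 = 0 := by
      intro a b hb
      rw [mem_neighborFinset] at hb
      rw [edgeHeight_of_not_adj (c := (a, b)) hb, edgeHeight_of_not_adj (c := (a, b)) hb]
      simp
    rw [summable_prod_of_nonneg fun c => sq_nonneg _]
    refine ⟨fun a => summable_of_ne_finset_zero (hfib a), ?_⟩
    -- Squaring the increment bound gives the ratio q^(-2), which beats the sphere growth (q+1)^n.
    have hsum := (hT.summable_pow_dist hreg (r := ((q : ℝ) ^ 2)⁻¹) (by positivity) (by
      rw [← div_eq_mul_inv, div_lt_one (by positivity)]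
      nlinarith) x).mul_left (((q : ℝ) + 1) * (2 * q ^ 2) ^ 2)
    refine hsum.of_nonneg_of_le (fun a => tsum_nonneg fun b => sq_nonneg _) fun a => ?_
    rw [tsum_eq_sum (s := T.neighborFinset a) fun b hb => hfib a b hb]
    refine (Finset.sum_le_card_nsmul _ _ ((2 * (q : ℝ) ^ 2 * ((q : ℝ) ^ T.dist x a)⁻¹) ^ 2)
      fun b _ => ?_).trans_eq ?_
    · rw [← sq_abs]
      exact pow_le_pow_left₀ (abs_nonneg _)
        (hT.abs_edgeHeight_sub_le (by omega) hyx.symm (a, b)) 2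
    · rw [card_neighborFinset_eq_degree, hreg a, nsmul_eq_mul, mul_pow, inv_pow, inv_pow,
        ← pow_mul, ← pow_mul, mul_comm 2 (T.dist x a)]
      push_cast
      ring
  -- Arbitrary pairs follow by telescoping along a walk.
  obtain ⟨W⟩ := hT.connected x y
  induction W with
  | @nil x =>
    have h0 : (fun c => ((T.edgeHeight q x c - T.edgeHeight q x c : ℝ) : 𝕜)) = 0 := by
      ext c
      simp
    rw [h0]
    exact zero_memℓp
  | @cons x z y h _ ih =>
    convert (hadj x z h).add ih using 1
    ext c
    simp

end Height

/-! ### The harmonic map and its affine action -/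

section Cocycle

variable (𝕜 : Type w) [RCLike 𝕜] {V : Type u} {T : SimpleGraph V} [T.LocallyFinite]

/-- The harmonic map to `ℓ²` of the oriented edges. -/
noncomputable def harmonicMap (hT : T.IsTree) {q : ℕ} (hq : 2 ≤ q)
    (hreg : T.IsRegularOfDegree (q + 1)) (x₀ x : V) : lp (fun _ : V × V => 𝕜) 2 :=
  ⟨fun c => ((T.edgeHeight q x c - T.edgeHeight q x₀ c : ℝ) : 𝕜),
    hT.memℓp_edgeHeight_sub 𝕜 hq hreg x x₀⟩

lemma harmonicMap_apply (hT : T.IsTree) {q : ℕ} (hq : 2 ≤ q)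
    (hreg : T.IsRegularOfDegree (q + 1)) (x₀ x : V) (c : V × V) :
    harmonicMap 𝕜 hT hq hreg x₀ x c = ((T.edgeHeight q x c - T.edgeHeight q x₀ c : ℝ) : 𝕜) := rfl

lemma harmonicMap_self (hT : T.IsTree) {q : ℕ} (hq : 2 ≤ q)
    (hreg : T.IsRegularOfDegree (q + 1)) (x₀ : V) : harmonicMap 𝕜 hT hq hreg x₀ x₀ = 0 := by
  ext c
  simp [harmonicMap_apply]

/-- The permutation of pairs of vertices induced by an automorphism. -/
def pairPerm (g : T ≃g T) : Equiv.Perm (V × V) := Equiv.prodCongr g.toEquiv g.toEquiv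

/-- Heights are invariant under automorphisms, so the reference terms at g x₀ cancel. This identity
yields both multiplicativity of the action and equivariance. -/
lemma lpPermute_harmonicMap (hT : T.IsTree) {q : ℕ} (hq : 2 ≤ q)
    (hreg : T.IsRegularOfDegree (q + 1)) (x₀ x : V) (g : T ≃g T) :
    lpPermute (pairPerm g) (harmonicMap 𝕜 hT hq hreg x₀ x) + harmonicMap 𝕜 hT hq hreg x₀ (g x₀) =
      harmonicMap 𝕜 hT hq hreg x₀ (g x) := by
  ext c
  obtain ⟨⟨a, b⟩, rfl⟩ := (pairPerm g).surjective c
  rw [lp.coeFn_add, Pi.add_apply, lpPermute_apply, Equiv.symm_apply_apply, harmonicMap_apply,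
    harmonicMap_apply, harmonicMap_apply, ← RCLike.ofReal_add]
  change ((_ + (T.edgeHeight q (g x₀) (g a, g b) - T.edgeHeight q x₀ (g a, g b)) : ℝ) : 𝕜) =
    ((T.edgeHeight q (g x) (g a, g b) - T.edgeHeight q x₀ (g a, g b) : ℝ) : 𝕜)
  rw [hT.connected.edgeHeight_map, hT.connected.edgeHeight_map]
  congr 1
  ring

/-- The affine isometric action on `ℓ²` of the oriented edges for which the harmonic map is
equivariant. -/
noncomputable def harmonicAction (hT : T.IsTree) {q : ℕ} (hq : 2 ≤ q)
    (hreg : T.IsRegularOfDegree (q + 1)) (x₀ : V) :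
    (T ≃g T) →* (lp (fun _ : V × V => 𝕜) 2 ≃ᵃⁱ[𝕜] lp (fun _ : V × V => 𝕜) 2) where
  toFun g := (lpPermute (pairPerm g)).toAffineIsometryEquiv.trans
    (AffineIsometryEquiv.constVAdd 𝕜 _ (harmonicMap 𝕜 hT hq hreg x₀ (g x₀)))
  map_one' := by
    ext1 ξ
    change harmonicMap 𝕜 hT hq hreg x₀ x₀ + ξ = ξ
    rw [harmonicMap_self, zero_add]
  map_mul' g h := by
    ext1 ξ
    change harmonicMap 𝕜 hT hq hreg x₀ (g (h x₀)) + lpPermute (pairPerm g)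
      (lpPermute (pairPerm h) ξ) = harmonicMap 𝕜 hT hq hreg x₀ (g x₀) +
        lpPermute (pairPerm g) (harmonicMap 𝕜 hT hq hreg x₀ (h x₀) + lpPermute (pairPerm h) ξ)
    rw [map_add, ← add_assoc, add_comm (harmonicMap 𝕜 hT hq hreg x₀ (g x₀)),
      lpPermute_harmonicMap]

lemma harmonicAction_apply (hT : T.IsTree) {q : ℕ} (hq : 2 ≤ q)
    (hreg : T.IsRegularOfDegree (q + 1)) (x₀ : V) (g : T ≃g T) (ξ : lp (fun _ : V × V => 𝕜) 2) :
    harmonicAction 𝕜 hT hq hreg x₀ g ξ =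
      lpPermute (pairPerm g) ξ + harmonicMap 𝕜 hT hq hreg x₀ (g x₀) := add_comm _ _

lemma isEquivariantMap_harmonicMap (hT : T.IsTree) {q : ℕ} (hq : 2 ≤ q)
    (hreg : T.IsRegularOfDegree (q + 1)) (x₀ : V) (G : Subgroup (T ≃g T)) :
    IsEquivariantMap ((harmonicAction 𝕜 hT hq hreg x₀).comp G.subtype)
      (harmonicMap 𝕜 hT hq hreg x₀) := fun g x =>
  ((harmonicAction_apply 𝕜 hT hq hreg x₀ g.1 _).trans
    (lpPermute_harmonicMap 𝕜 hT hq hreg x₀ x g.1)).symm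

lemma isHarmonicMap_harmonicMap (hT : T.IsTree) {q : ℕ} (hq : 2 ≤ q)
    (hreg : T.IsRegularOfDegree (q + 1)) (x₀ : V) :
    IsHarmonicMap 𝕜 T (harmonicMap 𝕜 hT hq hreg x₀) := by
  intro x
  have h2 : ((q + 1 : ℕ) : 𝕜) ≠ 0 := Nat.cast_ne_zero.mpr (Nat.succ_ne_zero q)
  rw [laplaceOp, sub_eq_zero, hreg x, inv_smul_eq_iff₀ h2]
  ext c
  rw [lp.coeFn_sum, Finset.sum_apply, lp.coeFn_smul, Pi.smul_apply, smul_eq_mul]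
  simp only [harmonicMap_apply]
  rw [← RCLike.ofReal_sum, Finset.sum_sub_distrib, hT.sum_edgeHeight (by omega) hreg,
    Finset.sum_const, card_neighborFinset_eq_degree, hreg x, nsmul_eq_mul]
  push_cast
  ring

lemma isNonconstantMap_harmonicMap (hT : T.IsTree) {q : ℕ} (hq : 2 ≤ q)
    (hreg : T.IsRegularOfDegree (q + 1)) (x₀ : V) :
    IsNonconstantMap (harmonicMap 𝕜 hT hq hreg x₀) := by
  obtain ⟨x, hx⟩ := hT.exists_dist_eq (by omega) hreg x₀ 1
  rw [dist_eq_one_iff_adj] at hx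
  refine ⟨x, x₀, fun h => ?_⟩
  have hq2 : (2 : ℝ) ≤ q := by exact_mod_cast hq
  -- In the coordinate of the edge (x₀, x), the height is q - 1 at x and -(q - 1) at x₀.
  have h1 := congrArg (fun f : lp (fun _ : V × V => 𝕜) 2 => f (x₀, x)) h
  simp only [harmonicMap_apply, sub_self] at h1
  rw [RCLike.ofReal_inj, edgeHeight_swap q x₀ x x₀,
    edgeHeight_of_dist_eq hx.symm (by rw [dist_self, dist_eq_one_iff_adj.mpr hx.symm]),
    edgeHeight_of_dist_eq hx (by rw [dist_self, dist_eq_one_iff_adj.mpr hx])] at h1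
  simp only [dist_self, pow_zero, inv_one] at h1
  linarith

end Cocycle

/-! ### Continuity of the action -/

section Continuity

variable {𝕜 : Type w} [RCLike 𝕜] {V : Type u} {T : SimpleGraph V}

/-- No regularity of φ is needed: g v and g w are locally constant in g. -/
lemma continuous_comp_apply {X : Type*} [TopologicalSpace X] (φ : V → V → X) (v w : V) :
    Continuous fun g : T ≃g T => φ (g v) (g w) := by
  let _ : TopologicalSpace V := ⊥
  have : DiscreteTopology V := ⟨rfl⟩
  have h : ∀ v, Continuous fun g : T ≃g T => g v := fun v =>
    continuous_discrete_rng.mpr fun w => isOpen_setOf_apply_eq v w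
  exact (continuous_of_discreteTopology (f := fun c : V × V => φ c.1 c.2)).comp
    ((h v).prodMk (h w))

/-- For a finitely supported vector the orbit map is locally constant; since all operators are
isometries, finite truncations of ξ converge uniformly in g. -/
lemma continuous_lpPermute_pairPerm (ξ : lp (fun _ : V × V => 𝕜) 2) :
    Continuous fun g : T ≃g T => lpPermute (pairPerm g) ξ := by
  classical
  have hlim : TendstoUniformly
      (fun (s : Finset (V × V)) (g : T ≃g T) =>
        lpPermute (pairPerm g) (∑ c ∈ s, lp.single 2 c (ξ c)))
      (fun g : T ≃g T => lpPermute (pairPerm g) ξ) Filter.atTop := by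
    rw [Metric.tendstoUniformly_iff]
    intro ε hε
    filter_upwards [Metric.tendsto_nhds.mp (lp.hasSum_single ENNReal.ofNat_ne_top ξ) ε hε]
      with s hs g
    rw [LinearIsometryEquiv.dist_map]
    exact (_root_.dist_comm _ _).trans_lt hs
  refine hlim.continuous (Filter.Frequently.of_forall fun s => ?_)
  simp only [map_sum, lpPermute_single]
  exact continuous_finsetSum _ fun c _ =>
    continuous_comp_apply (X := lp (fun _ : V × V => 𝕜) 2)
      (fun a b => lp.single 2 (a, b) (ξ c : 𝕜)) c.1 c.2

lemma continuous_harmonicAction [T.LocallyFinite] (hT : T.IsTree) {q : ℕ} (hq : 2 ≤ q)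
    (hreg : T.IsRegularOfDegree (q + 1)) (x₀ : V) (ξ : lp (fun _ : V × V => 𝕜) 2) :
    Continuous fun g : T ≃g T => harmonicAction 𝕜 hT hq hreg x₀ g ξ := by
  simp only [harmonicAction_apply]
  exact (continuous_lpPermute_pairPerm ξ).add
    (continuous_comp_apply (fun a _ => harmonicMap 𝕜 hT hq hreg x₀ a) x₀ x₀)

end Continuity

end SimpleGraph

theorem theorem2 {𝕜 : Type w} [RCLike 𝕜] {V : Type u} (q : ℕ) (hq : 2 ≤ q)
    (T : SimpleGraph V) [T.LocallyFinite] (hT : T.IsTree)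
    (hreg : T.IsRegularOfDegree (q + 1))
    (G : Subgroup (T ≃g T))
    (hclosed : IsClosed (G : Set (T ≃g T)))
    (hnoncompact : ¬ IsCompact (G : Set (T ≃g T)))
    (htransV : MulAction.IsPretransitive G V)
    (htransB : MulAction.IsPretransitive G (SimpleGraph.TreeBoundary T)) :
    (∀ (H : Type v) [NormedAddCommGroup H] [InnerProductSpace 𝕜 H] [CompleteSpace H]
        (α : G →* (H ≃ᵃⁱ[𝕜] H)) (F : V → H),
        SimpleGraph.IsEquivariantMap α F →
        ∀ x₀ x₁ : V, F x₀ = 0 → T.Adj x₀ x₁ →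
          ∀ A B : ℝ,
            A = ((q : ℝ) + 1) * ‖F x₁‖ ^ 2 / ((q : ℝ) - 1) →
            B = 2 * (q : ℝ) * ‖F x₁‖ ^ 2 / ((q : ℝ) - 1) ^ 2 →
            (∀ x : V, ‖F x‖ ^ 2 ≤ A * (T.dist x x₀ : ℝ) - B + B * ((q : ℝ) ^ T.dist x x₀)⁻¹) ∧
            (SimpleGraph.IsHarmonicMap 𝕜 T F → SimpleGraph.IsNonconstantMap F →
              ∀ x : V,
                ‖F x‖ ^ 2 = A * (T.dist x x₀ : ℝ) - B + B * ((q : ℝ) ^ T.dist x x₀)⁻¹)) ∧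
    (∃ (H : Type (max u w)) (_ : NormedAddCommGroup H) (_ : InnerProductSpace 𝕜 H)
        (_ : CompleteSpace H) (α : G →* (H ≃ᵃⁱ[𝕜] H)) (F : V → H),
        (∀ ξ : H, Continuous fun g : G => α g ξ) ∧
        SimpleGraph.IsEquivariantMap α F ∧
        SimpleGraph.IsHarmonicMap 𝕜 T F ∧
        SimpleGraph.IsNonconstantMap F) := by
  obtain ⟨x₀⟩ := hT.connected.nonempty
  refine ⟨fun H _ _ _ α F hF y₀ y₁ h0 h01 A B hA hB => ?_, ?_⟩
  · have h := hF.norm_sq_le hT hq hreg (fun x y x' y' hd =>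
      SimpleGraph.exists_map_pair_of_dist_eq hT hq hreg hclosed htransV htransB hd) h0 h01 hA hB
    exact ⟨h.1, fun hharm _ => h.2 hharm⟩
  · exact ⟨lp (fun _ : V × V => 𝕜) 2, inferInstance, inferInstance, inferInstance,
      (SimpleGraph.harmonicAction 𝕜 hT hq hreg x₀).comp G.subtype,
      SimpleGraph.harmonicMap 𝕜 hT hq hreg x₀,
      fun ξ => (SimpleGraph.continuous_harmonicAction hT hq hreg x₀ ξ).comp
        continuous_subtype_val,
      SimpleGraph.isEquivariantMap_harmonicMap 𝕜 hT hq hreg x₀ G,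
      SimpleGraph.isHarmonicMap_harmonicMap 𝕜 hT hq hreg x₀,
      SimpleGraph.isNonconstantMap_harmonicMap 𝕜 hT hq hreg x₀⟩
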